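/- Let $d\ge 1$, let $\pi$ be a probability measure on $\mathbb{R}^+=(0,\infty)$ with $\int_0^\infty \lambda^{-(2d+2)}\pi(d\lambda)<\infty$, let $b>0$, and let $W$ be a Lévy measure on $\mathbb{R}$ with $\int_{\mathbb{R}}x^2W(dx)<\infty$. Put \[\mathcal{K}(s)=-\frac b2 s^2+\int_{\mathbb{R}}\left(e^{isx}-1-isx\right)W(dx),\qquad s\in\mathbb{R}.\] Let $\mathcal S'$ be a ring of Borel subsets of $\mathbb{R}^+\times\mathbb{R}^d$ of finite $\pi\times Leb$ measure which is closed under countable intersections and contains an increasing sequence of sets with union $\mathbb{R}^+\times\mathbb{R}^d$, and let $\Lambda$ be an independently scattered infinitely divisible random measure on $\mathcal S'$ such that $\log E e^{is\Lambda(A)}=[\pi\times Leb](A)\,\mathcal{K}(s)$ for $A\in\mathcal S'$, $s\in\mathbb{R}$. Let $X$ be a measurable version of the (zero-mean) supCAR random field \[X(t)=-\int_0^\infty\int_{\mathbb{R}^d}\frac1{2\lambda}e^{-\lambda\|t-u\|}\,\Lambda(du,d\lambda),\qquad t\in\mathbb{R}^d,\] where the integral is the Rajput–Rosiński integral (the limit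 in probability of integrals of simple functions). Let $\Delta\subset\mathbb{R}^d$ be a bounded convex set containing the origin in its interior, $\Delta(T)=T\Delta$, and $X^*(T)=\int_{\Delta(T)}X(y)\,dy$. Then $X$ is almost surely integrable over $\Delta(T)$ for each $T$, and, as $T\to\infty$, the finite-dimensional distributions of the process \[\frac{1}{\sqrt{-c_5\,\mathcal{K}''(0)}\;T^{d/2}}\,X^*\!\left(t^{1/d}T\right),\qquad t\in[0,1],\] converge to those of the standard Brownian motion $B(t)$, $t\in[0,1]$, where \[c_5=|\Delta|\left(\frac{\pi^{d/2}\,\Gamma(d)}{\Gamma(d/2)}\right)^2\int_0^\infty\frac{\pi(d\lambda)}{\lambda^{2d+2}}\] (in $\pi^{d/2}$ the letter $\pi$ is the number). -/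

import Mathlib

open MeasureTheory ProbabilityTheory Filter
open scoped Topology NNReal Pointwise

noncomputable section

namespace SupCAR

/-- The parameter space `ℝ⁺ × ℝᵈ` of the pairs `(λ, u)`, with `ℝ⁺ = (0, ∞)`. -/
abbrev ParamSpace (d : ℕ) : Type := Set.Ioi (0 : ℝ) × EuclideanSpace ℝ (Fin d)

/-- The measure `π × Leb` on `ℝ⁺ × ℝᵈ`. -/
def controlMeasure {d : ℕ} (π : Measure (Set.Ioi (0 : ℝ))) : Measure (ParamSpace d) :=
  π.prod volume

/-- `W` is a Lévy measure on `ℝ`: `W {0} = 0` and `∫ min(1, x²) W(dx) < ∞`. -/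
structure IsLevyMeasure (W : Measure ℝ) : Prop where
  zero : W {0} = 0
  lintegral_lt_top : ∫⁻ x, ENNReal.ofReal (min 1 (x ^ 2)) ∂W < ⊤

/-- The cumulant function
`𝒦(s) = i a s - (b / 2) s² + ∫ (e^{isx} - 1 - i s x) W(dx)` (no truncation; it is used for
Lévy measures with finite second moment, and then `a` is the mean). -/
def cumulantFn (a b : ℝ) (W : Measure ℝ) (s : ℝ) : ℂ :=
  Complex.I * a * s - (b / 2 : ℝ) * (s : ℂ) ^ 2
    + ∫ x, (Complex.exp (Complex.I * s * x) - 1 - Complex.I * s * x) ∂W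

section RandomMeasure

variable {Z Ω : Type*} [MeasurableSpace Z] [MeasurableSpace Ω]

/-- The domain of a random measure: a ring of measurable sets of finite `μ`-measure, closed under
countable intersections, which contains an increasing sequence exhausting the space. -/
structure IsExhaustingDeltaRing (S : Set (Set Z)) (μ : Measure Z) : Prop where
  isSetRing : IsSetRing S
  iInter_mem : ∀ A : ℕ → Set Z, (∀ n, A n ∈ S) → (⋂ n, A n) ∈ S
  exhausting : ∃ A : ℕ → Set Z, (∀ n, A n ∈ S) ∧ Monotone A ∧ (⋃ n, A n) = Set.univ
  measurableSet : ∀ A ∈ S, MeasurableSet A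
  measure_lt_top : ∀ A ∈ S, μ A < ⊤

/-- `Λ` is an independently scattered infinitely divisible random measure on `S`, with control
measure `μ` and cumulant function `𝒦`: its values on disjoint sets are independent, it is
countably additive almost surely, and `log E e^{isΛ(A)} = μ(A) 𝒦(s)`. -/
structure IsScatteredRandomMeasure (P : Measure Ω) (S : Set (Set Z)) (μ : Measure Z)
    (K : ℝ → ℂ) (Λ : Set Z → Ω → ℝ) : Prop where
  aemeasurable : ∀ A ∈ S, AEMeasurable (Λ A) P
  indep : ∀ A : ℕ → Set Z, (∀ n, A n ∈ S) → Pairwise (Function.onFun Disjoint A) →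
    iIndepFun (fun n => Λ (A n)) P
  additive : ∀ A : ℕ → Set Z, (∀ n, A n ∈ S) → Pairwise (Function.onFun Disjoint A) →
    (⋃ n, A n) ∈ S →
    ∀ᵐ ω ∂P, Tendsto (fun N => ∑ n ∈ Finset.range N, Λ (A n) ω) atTop (𝓝 (Λ (⋃ n, A n) ω))
  charFun_eq : ∀ A ∈ S, ∀ s : ℝ,
    ∫ ω, Complex.exp (Complex.I * s * Λ A ω) ∂P = Complex.exp ((μ A).toReal * K s)

/-- A simple function `∑ i, aᵢ 1_{Aᵢ}` over `S`, with pairwise disjoint sets `Aᵢ ∈ S`. -/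
structure SimpleFn (S : Set (Set Z)) where
  /-- number of terms -/
  size : ℕ
  /-- coefficients -/
  coef : Fin size → ℝ
  /-- sets -/
  sets : Fin size → Set Z
  sets_mem : ∀ i, sets i ∈ S
  sets_disjoint : Pairwise (Function.onFun Disjoint sets)

/-- The function represented by a simple function. -/
def SimpleFn.eval {S : Set (Set Z)} (φ : SimpleFn S) (z : Z) : ℝ :=
  ∑ i, (φ.sets i).indicator (fun _ => φ.coef i) z

/-- The integral `∑ i, aᵢ Λ(Aᵢ ∩ B)` of a simple function over the set `B`. -/
def SimpleFn.integral {S : Set (Set Z)} (φ : SimpleFn S) (Λ : Set Z → Ω → ℝ) (B : Set Z)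
    (ω : Ω) : ℝ :=
  ∑ i, φ.coef i * Λ (φ.sets i ∩ B) ω

/-- `f` is integrable with respect to the random measure `Λ` in the sense of Rajput and Rosiński,
and `ξ` is (a version of) its integral over the whole space: there are simple functions
converging to `f` almost everywhere, whose integrals over every set of the `σ`-algebra generated
by `S` converge in probability, the integrals over the whole space converging to `ξ`. -/
def IsRandomIntegral (P : Measure Ω) (S : Set (Set Z)) (μ : Measure Z) (Λ : Set Z → Ω → ℝ)
    (f : Z → ℝ) (ξ : Ω → ℝ) : Prop :=
  ∃ φ : ℕ → SimpleFn S,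
    (∀ᵐ z ∂μ, Tendsto (fun n => (φ n).eval z) atTop (𝓝 (f z))) ∧
    (∀ B : Set Z, MeasurableSet[MeasurableSpace.generateFrom S] B →
      ∃ η : Ω → ℝ, AEMeasurable η P ∧
        TendstoInMeasure P (fun n => (φ n).integral Λ B) atTop η) ∧
    AEMeasurable ξ P ∧ TendstoInMeasure P (fun n => (φ n).integral Λ Set.univ) atTop ξ

end RandomMeasure

/-- The kernel `-(1 / (2λ)) e^{-λ ‖t - u‖}`. -/
def kernel {d : ℕ} (t : EuclideanSpace ℝ (Fin d)) (z : ParamSpace d) : ℝ :=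
  -(1 / (2 * (z.1 : ℝ)) * Real.exp (-(z.1 : ℝ) * ‖t - z.2‖))

/-- `X` is a supCAR random field with characteristic quadruple `(a, b, W, π)₁`:
`X(t) = -∫∫ (1 / (2λ)) e^{-λ ‖t - u‖} Λ(du, dλ)` almost surely for every `t`, where `Λ` is an
independently scattered infinitely divisible random measure on `ℝ⁺ × ℝᵈ` with
`log E e^{isΛ(A)} = (π × Leb)(A) 𝒦(s)`. -/
def IsSupCARField {Ω : Type*} [MeasurableSpace Ω] (P : Measure Ω) {d : ℕ}
    (a b : ℝ) (W : Measure ℝ) (π : Measure (Set.Ioi (0 : ℝ)))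
    (X : EuclideanSpace ℝ (Fin d) → Ω → ℝ) : Prop :=
  ∃ (S : Set (Set (ParamSpace d))) (Λ : Set (ParamSpace d) → Ω → ℝ),
    IsExhaustingDeltaRing S (controlMeasure π) ∧
    IsScatteredRandomMeasure P S (controlMeasure π) (cumulantFn a b W) Λ ∧
    ∀ t, IsRandomIntegral P S (controlMeasure π) Λ (kernel t) (X t)

/-- The integrated field `X*(T) = ∫_{Δ(T)} X(y) dy`, where `Δ(T) = T Δ`. -/
def integratedField {Ω : Type*} {d : ℕ} (Δ : Set (EuclideanSpace ℝ (Fin d)))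
    (X : EuclideanSpace ℝ (Fin d) → Ω → ℝ) (T : ℝ) (ω : Ω) : ℝ :=
  ∫ y in T • Δ, X y ω

/-- The constant `c₅ = |Δ| (π^{d/2} Γ(d) / Γ(d/2))² ∫ λ^{-(2d+2)} π(dλ)`. -/
def c5 {d : ℕ} (Δ : Set (EuclideanSpace ℝ (Fin d))) (π : Measure (Set.Ioi (0 : ℝ))) : ℝ :=
  (volume Δ).toReal
    * (Real.pi ^ ((d : ℝ) / 2) * Real.Gamma d / Real.Gamma ((d : ℝ) / 2)) ^ 2
    * ∫ l : Set.Ioi (0 : ℝ), ((l : ℝ) ^ (2 * d + 2))⁻¹ ∂π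

end SupCAR

end

noncomputable section

namespace SupCAR

/-! ### Regularity and growth of the cumulant function. -/

section Cumulant

/-! Write μ = π × Leb and σ² = `levyVariance b W` = -𝒦''(0). The proof computes characteristic
functions exactly and passes to the limit in the exponent.

Exact formula. Independence on disjoint sets gives E exp(iY) = exp ∫ 𝒦(g) dμ for a finite sum Y = Σ
aᵢ Λ(Aᵢ) and g = Σ aᵢ 1_{Aᵢ}. Both sides are continuous in L², so the formula extends to the closed
span `integralGraph` of such pairs (g, Y) (`charFun_of_mem_integralGraph`). The Rajput–Rosiński
integral is only a limit in probability, but b > 0 gives |E exp(iY)| ≤ exp(-(b/2)‖g‖²), so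
convergence in probability of the integrals forces the integrands to be Cauchy in L²
(`IsRandomIntegral.exists_mem_integralGraph`). Hence each pair (`kernel t`, X(t)) lies in the graph.
It depends continuously on t, and its Bochner integral over a bounded set stays in the closed graph:
this is the stochastic Fubini theorem (`exists_mem_integralGraph_setIntegral`).

Limit. Substituting u = Tv turns the kernel integrated over T • A into -(1/2) λ^{-(d+1)} times 1_A
smoothed at scale 1/(λT). The Jacobian T^d is the square of the normalisation n = T^{d/2}, and n²
𝒦(x/n) → -σ²x²/2. Dominated convergence, first in v and then in λ, where the moment of order 2d+2
enters, gives a quadratic form in the overlaps |Aᵢ ∩ Aⱼ|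
(`tendsto_integral_cumulantFn_integratedKernel`). For Aᵢ = tᵢ^{1/d} • Δ the sets are nested and the
overlaps are min(tᵢ, tⱼ)|Δ|, the Brownian covariance. The constant `c5` collects |Δ|, the moment of
π and (M/2)², with M the integral of e^{-‖w‖}. Lévy's continuity theorem concludes. -/

lemma norm_exp_I_mul_sub_one_sub_le (y : ℝ) :
    ‖Complex.exp (Complex.I * y) - 1 - Complex.I * y‖ ≤ 3 * y ^ 2 := by
  have hn : ‖Complex.I * (y : ℂ)‖ = |y| := by simp
  rcases le_or_gt |y| 1 with h | h
  · have := Complex.norm_exp_sub_one_sub_id_le (x := Complex.I * y) (by rw [hn]; exact h)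
    rw [hn, sq_abs] at this
    nlinarith [sq_nonneg y]
  · have h1 : ‖Complex.exp (Complex.I * y) - 1‖ ≤ |y| := by
      simpa using Real.norm_exp_I_mul_ofReal_sub_one_le (x := y)
    have h2 := norm_sub_le (Complex.exp (Complex.I * y) - 1) (Complex.I * y)
    rw [hn] at h2
    nlinarith [sq_abs y]

lemma norm_exp_I_mul_mul_sub_one_le (s x : ℝ) :
    ‖Complex.exp (Complex.I * s * x) - 1‖ ≤ |s| * |x| := by
  have := Real.norm_exp_I_mul_ofReal_sub_one_le (x := s * x)
  push_cast at this
  rw [← mul_assoc] at this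
  simpa [abs_mul] using this

variable {b : ℝ} {W : Measure ℝ}

lemma norm_levyIntegrand_le (s x : ℝ) :
    ‖Complex.exp (Complex.I * s * x) - 1 - Complex.I * s * x‖ ≤ 3 * s ^ 2 * x ^ 2 := by
  have := norm_exp_I_mul_sub_one_sub_le (s * x)
  push_cast at this
  rw [← mul_assoc] at this
  linarith [mul_pow s x 2]

lemma integrable_levyIntegrand (hW2 : Integrable (fun x : ℝ => x ^ 2) W) (s : ℝ) :
    Integrable (fun x : ℝ => Complex.exp (Complex.I * s * x) - 1 - Complex.I * s * x) W := by
  refine (hW2.const_mul (3 * s ^ 2)).mono' (by fun_prop) (ae_of_all _ fun x => ?_)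
  exact norm_levyIntegrand_le s x

lemma norm_levyIntegrand_deriv_le (s x : ℝ) :
    ‖Complex.I * x * (Complex.exp (Complex.I * s * x) - 1)‖ ≤ |s| * x ^ 2 := by
  rw [norm_mul]
  have := norm_exp_I_mul_mul_sub_one_le s x
  have h2 : ‖Complex.I * (x : ℂ)‖ = |x| := by simp
  rw [h2]
  calc |x| * _ ≤ |x| * (|s| * |x|) := by gcongr
    _ = |s| * x ^ 2 := by rw [← sq_abs x]; ring

/-- The derivative of the cumulant function. -/
def cumulantDeriv (b : ℝ) (W : Measure ℝ) (s : ℝ) : ℂ :=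
  -((b : ℂ) * s) + ∫ x, Complex.I * x * (Complex.exp (Complex.I * s * x) - 1) ∂W

/-- The variance `b + ∫ x² W(dx)` of the infinitely divisible law with cumulant function `𝒦`. -/
def levyVariance (b : ℝ) (W : Measure ℝ) : ℝ := b + ∫ x, x ^ 2 ∂W

lemma levyVariance_nonneg (hb : 0 ≤ b) : 0 ≤ levyVariance b W := by
  have : 0 ≤ ∫ x, x ^ 2 ∂W := integral_nonneg fun x => by positivity
  unfold levyVariance; linarith

lemma levyVariance_pos (hb : 0 < b) : 0 < levyVariance b W := by
  have : 0 ≤ ∫ x, x ^ 2 ∂W := integral_nonneg fun x => by positivity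
  unfold levyVariance; linarith

/-- Differentiation under the integral: on the unit ball around s the differentiated integrand is
dominated by (|s| + 1)x², which the second moment of W makes integrable. -/
lemma hasDerivAt_cumulantFn (hW2 : Integrable (fun x : ℝ => x ^ 2) W) (s : ℝ) :
    HasDerivAt (cumulantFn 0 b W) (cumulantDeriv b W s) s := by
  have h1 : HasDerivAt (fun s : ℝ => ∫ x,
      (Complex.exp (Complex.I * s * x) - 1 - Complex.I * s * x) ∂W)
      (∫ x, Complex.I * x * (Complex.exp (Complex.I * s * x) - 1) ∂W) s := by
    refine (hasDerivAt_integral_of_dominated_loc_of_deriv_le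
      (F := fun (s : ℝ) (x : ℝ) => Complex.exp (Complex.I * s * x) - 1 - Complex.I * s * x)
      (F' := fun (s : ℝ) (x : ℝ) => Complex.I * x * (Complex.exp (Complex.I * s * x) - 1))
      (bound := fun x => (|s| + 1) * x ^ 2)
      (Metric.ball_mem_nhds s one_pos) (Eventually.of_forall fun _ => by fun_prop)
      (integrable_levyIntegrand hW2 s) (by fun_prop) (ae_of_all _ fun x r hr => ?_)
      (hW2.const_mul _) (ae_of_all _ fun x r _ => ?_)).2
    · refine (norm_levyIntegrand_deriv_le r x).trans ?_
      have : |r| ≤ |s| + 1 := by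
        have h := abs_sub_abs_le_abs_sub r s
        rw [Metric.mem_ball, Real.dist_eq] at hr
        linarith
      gcongr
    · have h0 : HasDerivAt (fun r : ℝ => Complex.I * r * x) (Complex.I * x) r := by
        simpa using ((Complex.ofRealCLM.hasDerivAt (x := r)).const_mul Complex.I).mul_const (x : ℂ)
      convert! (h0.cexp.sub_const 1).sub h0 using 1
      ring
  have h2 : HasDerivAt (fun s : ℝ => ((b / 2 : ℝ) : ℂ) * (s : ℂ) ^ 2) ((b : ℂ) * s) s := by
    have := ((Complex.ofRealCLM.hasDerivAt (x := s)).pow 2).const_mul ((b / 2 : ℝ) : ℂ)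
    convert! this using 1
    simp; ring
  have h3 := (h2.neg).add h1
  unfold cumulantDeriv
  refine h3.congr_of_eventuallyEq (Eventually.of_forall fun r => ?_)
  simp [cumulantFn]

lemma integrable_levyIntegrand_deriv (hW2 : Integrable (fun x : ℝ => x ^ 2) W) (s : ℝ) :
    Integrable (fun x : ℝ => Complex.I * x * (Complex.exp (Complex.I * s * x) - 1)) W :=
  (hW2.const_mul |s|).mono' (by fun_prop) (ae_of_all _ fun x => norm_levyIntegrand_deriv_le s x)

lemma norm_cumulantDeriv_le (hb : 0 ≤ b) (hW2 : Integrable (fun x : ℝ => x ^ 2) W) (s : ℝ) :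
    ‖cumulantDeriv b W s‖ ≤ levyVariance b W * |s| := by
  have h1 : ‖∫ x, Complex.I * x * (Complex.exp (Complex.I * s * x) - 1) ∂W‖
      ≤ ∫ x, |s| * x ^ 2 ∂W :=
    norm_integral_le_of_norm_le (hW2.const_mul _)
      (ae_of_all _ fun x => norm_levyIntegrand_deriv_le s x)
  rw [integral_const_mul] at h1
  refine (norm_add_le _ _).trans ?_
  have h2 : ‖-((b : ℂ) * s)‖ = b * |s| := by simp [abs_of_nonneg hb]
  rw [h2, levyVariance]
  linarith

lemma hasDerivAt_cumulantDeriv_zero (hW2 : Integrable (fun x : ℝ => x ^ 2) W) :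
    HasDerivAt (cumulantDeriv b W) (-(levyVariance b W : ℂ)) 0 := by
  have h1 : HasDerivAt (fun s : ℝ => ∫ x,
      Complex.I * x * (Complex.exp (Complex.I * s * x) - 1) ∂W)
      (∫ x : ℝ, Complex.I * x * (Complex.exp (Complex.I * (0 : ℝ) * x) * (Complex.I * x)) ∂W) 0 := by
    refine (hasDerivAt_integral_of_dominated_loc_of_deriv_le
      (F := fun (s : ℝ) (x : ℝ) => Complex.I * x * (Complex.exp (Complex.I * s * x) - 1))
      (F' := fun (s : ℝ) (x : ℝ) =>
        Complex.I * x * (Complex.exp (Complex.I * s * x) * (Complex.I * x)))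
      (bound := fun x => x ^ 2)
      (Metric.ball_mem_nhds 0 one_pos) (Eventually.of_forall fun _ => by fun_prop)
      (integrable_levyIntegrand_deriv hW2 0) (by fun_prop) (ae_of_all _ fun x r hr => ?_)
      hW2 (ae_of_all _ fun x r _ => ?_)).2
    · have : ‖Complex.exp (Complex.I * r * x)‖ = 1 := by
        rw [show Complex.I * r * x = ((r * x : ℝ) : ℂ) * Complex.I by push_cast; ring,
          Complex.norm_exp_ofReal_mul_I]
      simp only [norm_mul, this, Complex.norm_I, Complex.norm_real, Real.norm_eq_abs]
      rw [← sq_abs x]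
      apply le_of_eq; ring
    · have h0 : HasDerivAt (fun r : ℝ => Complex.I * r * x) (Complex.I * x) r := by
        simpa using ((Complex.ofRealCLM.hasDerivAt (x := r)).const_mul Complex.I).mul_const (x : ℂ)
      exact (h0.cexp.sub_const 1).const_mul _
  have h2 : HasDerivAt (fun s : ℝ => -((b : ℂ) * s)) (-(b : ℂ)) 0 := by
    convert! ((Complex.ofRealCLM.hasDerivAt (x := 0)).const_mul (b : ℂ)).neg using 1
    simp
  have h3 : (∫ x : ℝ, Complex.I * x * (Complex.exp (Complex.I * (0 : ℝ) * x) * (Complex.I * x)) ∂W)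
      = -((∫ x, x ^ 2 ∂W : ℝ) : ℂ) := by
    rw [← integral_complex_ofReal, ← integral_neg]
    congr 1; ext x
    simp only [Complex.ofReal_zero, mul_zero, zero_mul, Complex.exp_zero, one_mul]
    push_cast
    linear_combination (x : ℂ) ^ 2 * Complex.I_sq
  rw [h3] at h1
  convert! h2.add h1 using 1
  simp [levyVariance]; ring

lemma iteratedDeriv_two_cumulantFn (hW2 : Integrable (fun x : ℝ => x ^ 2) W) :
    iteratedDeriv 2 (cumulantFn 0 b W) 0 = -(levyVariance b W : ℂ) := by
  rw [iteratedDeriv_succ, iteratedDeriv_one]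
  have : deriv (cumulantFn 0 b W) = cumulantDeriv b W :=
    funext fun s => (hasDerivAt_cumulantFn hW2 s).deriv
  rw [this, (hasDerivAt_cumulantDeriv_zero hW2).deriv]

@[simp] lemma cumulantFn_zero : cumulantFn 0 b W 0 = 0 := by simp [cumulantFn]

lemma cumulantDeriv_zero : cumulantDeriv b W 0 = 0 := by simp [cumulantDeriv]

lemma continuous_cumulantFn (hW2 : Integrable (fun x : ℝ => x ^ 2) W) :
    Continuous (cumulantFn 0 b W) :=
  continuous_iff_continuousAt.2 fun s => (hasDerivAt_cumulantFn hW2 s).continuousAt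

/-- Mean value inequality with |𝒦'(x)| ≤ σ²|x| between r and s. The product form of the bound is
what Cauchy–Schwarz needs to make g ↦ ∫ 𝒦(g) continuous on L². -/
lemma norm_cumulantFn_sub_le (hb : 0 ≤ b) (hW2 : Integrable (fun x : ℝ => x ^ 2) W) (s r : ℝ) :
    ‖cumulantFn 0 b W s - cumulantFn 0 b W r‖ ≤ levyVariance b W * (|s| + |r|) * |s - r| := by
  have hσ : 0 ≤ levyVariance b W := levyVariance_nonneg hb
  have := (convex_uIcc r s).norm_image_sub_le_of_norm_hasDerivWithin_le
    (f := cumulantFn 0 b W) (f' := cumulantDeriv b W) (C := levyVariance b W * (|s| + |r|))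
    (fun x _ => (hasDerivAt_cumulantFn hW2 x).hasDerivWithinAt) (fun x hx => ?_)
    Set.left_mem_uIcc Set.right_mem_uIcc
  · simpa using this
  · refine (norm_cumulantDeriv_le hb hW2 x).trans ?_
    gcongr
    rcases Set.mem_uIcc.1 hx with ⟨h1, h2⟩ | ⟨h1, h2⟩ <;>
    · rw [abs_le]
      constructor <;> linarith [neg_abs_le s, neg_abs_le r, le_abs_self s, le_abs_self r,
        abs_nonneg s, abs_nonneg r]

lemma norm_cumulantFn_le (hb : 0 ≤ b) (hW2 : Integrable (fun x : ℝ => x ^ 2) W) (s : ℝ) :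
    ‖cumulantFn 0 b W s‖ ≤ levyVariance b W * s ^ 2 := by
  have := norm_cumulantFn_sub_le hb hW2 s 0
  simp only [cumulantFn_zero, sub_zero, abs_zero, add_zero] at this
  rwa [mul_assoc, ← sq, sq_abs] at this

/-- The jump part contributes cos(sx) - 1 ≤ 0 to the real part, so the Gaussian term alone bounds it
from above. All decay of characteristic functions used later comes from here. -/
lemma re_cumulantFn_le (hW2 : Integrable (fun x : ℝ => x ^ 2) W) (s : ℝ) :
    (cumulantFn 0 b W s).re ≤ -(b / 2) * s ^ 2 := by
  have h : (∫ x, (Complex.exp (Complex.I * s * x) - 1 - Complex.I * s * x) ∂W).re ≤ 0 := by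
    rw [← RCLike.re_eq_complex_re, ← integral_re (integrable_levyIntegrand hW2 s)]
    refine integral_nonpos fun x => ?_
    simp only [RCLike.re_eq_complex_re, Pi.zero_apply]
    rw [show Complex.I * s * x = ((s * x : ℝ) : ℂ) * Complex.I by push_cast; ring]
    simp only [Complex.sub_re, Complex.exp_ofReal_mul_I_re, Complex.one_re, Complex.re_ofReal_mul,
      Complex.I_re, mul_zero]
    linarith [Real.cos_le_one (s * x)]
  unfold cumulantFn
  simp only [Complex.add_re, Complex.sub_re]
  have h2 : (((b / 2 : ℝ) : ℂ) * (s : ℂ) ^ 2).re = b / 2 * s ^ 2 := by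
    rw [← Complex.ofReal_pow, ← Complex.ofReal_mul, Complex.ofReal_re]
  rw [h2]
  simp
  linarith

/-- Second order Taylor expansion of the cumulant function at `0`. -/
lemma cumulantFn_taylor (hW2 : Integrable (fun x : ℝ => x ^ 2) W) {ε : ℝ} (hε : 0 < ε) :
    ∃ δ > 0, ∀ s : ℝ, |s| ≤ δ →
      ‖cumulantFn 0 b W s + (levyVariance b W / 2 : ℝ) * (s : ℂ) ^ 2‖ ≤ ε * s ^ 2 := by
  have h := (hasDerivAt_cumulantDeriv_zero (b := b) hW2).isLittleO
  simp only [cumulantDeriv_zero, sub_zero] at h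
  have h' := h.def hε
  rw [Metric.eventually_nhds_iff_ball] at h'
  obtain ⟨δ, hδ, hball⟩ := h'
  refine ⟨δ / 2, by positivity, fun s hs => ?_⟩
  have hd : ∀ x : ℝ, HasDerivAt
      (fun s : ℝ => cumulantFn 0 b W s + (levyVariance b W / 2 : ℝ) * (s : ℂ) ^ 2)
      (cumulantDeriv b W x + levyVariance b W * x) x := fun x => by
    have h2 := ((Complex.ofRealCLM.hasDerivAt (x := x)).pow 2).const_mul
      ((levyVariance b W / 2 : ℝ) : ℂ)
    convert! (hasDerivAt_cumulantFn (b := b) hW2 x).add h2 using 1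
    simp; ring
  -- The derivative 𝒦'(x) + σ²x is o(x) at 0; integrating it over the segment from 0 to s gains a
  -- second factor |s|.
  have := (convex_uIcc 0 s).norm_image_sub_le_of_norm_hasDerivWithin_le (C := ε * |s|)
    (fun x _ => (hd x).hasDerivWithinAt) (fun x hx => ?_) Set.left_mem_uIcc Set.right_mem_uIcc
  · simp only [cumulantFn_zero, Complex.ofReal_zero, sub_zero, Real.norm_eq_abs] at this
    calc _ ≤ ε * |s| * |s| := by simpa using this
      _ = ε * s ^ 2 := by rw [mul_assoc, ← sq, sq_abs]
  · have hxs : |x| ≤ |s| := by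
      simpa using Set.abs_sub_left_of_mem_uIcc hx
    have hb := hball x (by rw [Metric.mem_ball, dist_zero_right, Real.norm_eq_abs]; linarith)
    have e : cumulantDeriv b W x + levyVariance b W * x
        = cumulantDeriv b W x - x • (-(levyVariance b W : ℂ)) := by
      simp [mul_comm]
    rw [e]
    refine hb.trans ?_
    rw [Real.norm_eq_abs]
    gcongr

end Cumulant

/-! ### Atoms of a finite family of sets. -/

section SetFamily

variable {Z : Type*} {S : Set (Set Z)} {K : ℝ → ℂ}

lemma apply_sum_indicator_of_disjoint {ι : Type*} [Fintype ι] {A : ι → Set Z}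
    (hd : Pairwise (Function.onFun Disjoint A)) (hK : K 0 = 0) (a : ι → ℝ) (z : Z) :
    K (∑ i, (A i).indicator (fun _ => a i) z) = ∑ i, (A i).indicator (fun _ => K (a i)) z := by
  classical
  by_cases h : ∃ i, z ∈ A i
  · obtain ⟨i, hi⟩ := h
    have hne : ∀ j, j ≠ i → z ∉ A j := fun j hj hz =>
      Set.disjoint_left.1 (hd hj) hz hi
    rw [Finset.sum_eq_single i (fun j _ hj => by simp [hne j hj]) (by simp),
      Finset.sum_eq_single i (fun j _ hj => by simp [hne j hj]) (by simp)]
    simp [hi]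
  · push Not at h
    simp [h, hK]

/-- The atom of the points that belong to exactly the sets `A i`, `i ∈ σ`. -/
def familyAtom {ι : Type*} (A : ι → Set Z) (σ : Finset ι) : Set Z := {z | ∀ i, z ∈ A i ↔ i ∈ σ}

lemma familyAtom_mem (hS : IsSetRing S) {ι : Type*} [Fintype ι] {A : ι → Set Z}
    (hA : ∀ i, A i ∈ S) {σ : Finset ι} (hσ : σ.Nonempty) : familyAtom A σ ∈ S := by
  classical
  have : familyAtom A σ = (⋂ i ∈ σ, A i) \ ⋃ i ∈ σᶜ, A i := by
    ext z
    simp only [familyAtom, Set.mem_ofPred_eq, Set.mem_sdiff, Set.mem_iInter, Set.mem_iUnion,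
      Finset.mem_compl, not_exists]
    exact ⟨fun h => ⟨fun i hi => (h i).2 hi, fun i hi hz => hi ((h i).1 hz)⟩,
      fun h i => ⟨fun hz => by_contra fun hi => h.2 i hi hz, fun hi => h.1 i hi⟩⟩
  rw [this]
  exact hS.sdiff_mem (hS.biInter_mem σ hσ fun i _ => hA i) (hS.biUnion_mem _ fun i _ => hA i)

lemma pairwise_disjoint_familyAtom {ι : Type*} (A : ι → Set Z) :
    Pairwise (Function.onFun Disjoint (familyAtom A)) := fun _ _ h =>
  Set.disjoint_left.2 fun _ h1 h2 => h (Finset.ext fun i => (h1 i).symm.trans (h2 i))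

end SetFamily

/-! ### Finite-dimensional laws of the random measure. -/

section RandomMeasure

variable {Z Ω : Type*} [MeasurableSpace Z] [MeasurableSpace Ω] {P : Measure Ω}
  {S : Set (Set Z)} {μ : Measure Z} {K : ℝ → ℂ} {Λ : Set Z → Ω → ℝ}

/-- Additivity along the constant sequence ∅ makes N · Λ(∅) converge almost surely, so its increment
Λ(∅) must vanish. -/
lemma IsScatteredRandomMeasure.empty_ae_eq (hΛ : IsScatteredRandomMeasure P S μ K Λ)
    (hS : IsSetRing S) : Λ ∅ =ᵐ[P] 0 := by
  have h := hΛ.additive (fun _ => ∅) (fun _ => hS.empty_mem) (fun i j _ => by simp [Function.onFun])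
    (by simpa using hS.empty_mem)
  filter_upwards [h] with ω hω
  simp only [Finset.sum_const, Finset.card_range, Set.iUnion_empty, nsmul_eq_mul] at hω
  have h1 := (tendsto_add_atTop_iff_nat 1).2 hω
  have h2 := h1.sub hω
  simp only [Nat.cast_add, Nat.cast_one, sub_self] at h2
  have h3 : (fun n : ℕ => ((n : ℝ) + 1) * Λ ∅ ω - n * Λ ∅ ω) = fun _ => Λ ∅ ω := by
    ext n; ring
  rw [h3] at h2
  exact tendsto_nhds_unique tendsto_const_nhds h2

lemma IsScatteredRandomMeasure.union_ae_eq (hΛ : IsScatteredRandomMeasure P S μ K Λ)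
    (hS : IsSetRing S) {A B : Set Z} (hA : A ∈ S) (hB : B ∈ S) (hAB : Disjoint A B) :
    Λ (A ∪ B) =ᵐ[P] fun ω => Λ A ω + Λ B ω := by
  set C : ℕ → Set Z := fun n => if n = 0 then A else if n = 1 then B else ∅ with hC
  have hU : (⋃ n, C n) = A ∪ B := by
    ext z
    simp only [Set.mem_iUnion, Set.mem_union, hC]
    constructor
    · rintro ⟨n, hn⟩
      split_ifs at hn with h0 h1
      · exact Or.inl hn
      · exact Or.inr hn
      · exact hn.elim
    · rintro (h | h)
      · exact ⟨0, by simpa using h⟩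
      · exact ⟨1, by simpa using h⟩
  have h := hΛ.additive C (fun n => by
      simp only [hC]; split_ifs
      exacts [hA, hB, hS.empty_mem])
    (fun i j hij => by
      simp only [Function.onFun, hC]
      split_ifs <;> first | omega | simp_all [disjoint_comm])
    (by rw [hU]; exact hS.union_mem hA hB)
  filter_upwards [h, hΛ.empty_ae_eq hS] with ω hω h0
  rw [hU] at hω
  refine tendsto_nhds_unique hω ?_
  refine tendsto_const_nhds.congr' ?_
  filter_upwards [eventually_ge_atTop 2] with N hN
  rw [← Finset.sum_subset (s₁ := Finset.range 2) (by simpa using hN)]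
  · simp [Finset.sum_range_succ, hC]
  · intro n _ hn
    have : n ≠ 0 ∧ n ≠ 1 := by
      simp only [Finset.mem_range] at hn; omega
    simpa [hC, this.1, this.2] using h0

lemma IsScatteredRandomMeasure.biUnion_ae_eq (hΛ : IsScatteredRandomMeasure P S μ K Λ)
    (hS : IsSetRing S) {ι : Type*} {A : ι → Set Z} (hA : ∀ i, A i ∈ S)
    (hd : Pairwise (Function.onFun Disjoint A)) (s : Finset ι) :
    Λ (⋃ i ∈ s, A i) =ᵐ[P] fun ω => ∑ i ∈ s, Λ (A i) ω := by
  classical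
  induction s using Finset.induction_on with
  | empty => simpa [EventuallyEq] using hΛ.empty_ae_eq hS
  | insert a s ha ih =>
    have h := hΛ.union_ae_eq hS (hA a) (hS.biUnion_mem s (fun i _ => hA i))
      (Set.disjoint_iUnion₂_right.2 fun i hi => hd (fun h => ha (h ▸ hi)))
    rw [Finset.set_biUnion_insert]
    filter_upwards [h, ih] with ω h1 h2
    rw [h1, h2, Finset.sum_insert ha]

lemma IsScatteredRandomMeasure.iIndepFun_fintype (hΛ : IsScatteredRandomMeasure P S μ K Λ)
    (hS : IsSetRing S) {ι : Type*} [Fintype ι] {A : ι → Set Z} (hA : ∀ i, A i ∈ S)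
    (hd : Pairwise (Function.onFun Disjoint A)) : iIndepFun (fun i => Λ (A i)) P := by
  classical
  set e := Fintype.equivFin ι
  set B : ℕ → Set Z := fun n => if h : n < Fintype.card ι then A (e.symm ⟨n, h⟩) else ∅ with hB
  have h := hΛ.indep B (fun n => by
      simp only [hB]; split_ifs
      exacts [hA _, hS.empty_mem])
    (fun i j hij => by
      simp only [Function.onFun, hB]
      split_ifs with h1 h2
      · exact hd (fun h => hij (by simpa using h))
      all_goals simp)
  have h2 := h.precomp (g := fun i : ι => (e i : ℕ)) (fun i j hij => by
    exact e.injective (Fin.ext hij))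
  convert! h2 using 2 with i
  simp [hB]

lemma IsScatteredRandomMeasure.charFun_of_disjoint (hΛ : IsScatteredRandomMeasure P S μ K Λ)
    (hS : IsExhaustingDeltaRing S μ) (hK : K 0 = 0) {ι : Type*} [Fintype ι] {A : ι → Set Z}
    (hA : ∀ i, A i ∈ S) (hd : Pairwise (Function.onFun Disjoint A)) (a : ι → ℝ) :
    ∫ ω, Complex.exp (Complex.I * (∑ i, a i * Λ (A i) ω : ℝ)) ∂P
      = Complex.exp (∫ z, K (∑ i, (A i).indicator (fun _ => a i) z) ∂μ) := by
  have h1 := (hΛ.iIndepFun_fintype hS.isSetRing hA hd).integral_fun_prod_comp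
    (𝕜 := ℂ) (f := fun i (x : ℝ) => Complex.exp (Complex.I * a i * x)) (fun i => hΛ.aemeasurable (A i) (hA i))
    (fun i => by fun_prop)
  have h2 : ∀ ω, ∏ i, Complex.exp (Complex.I * a i * (Λ (A i) ω))
      = Complex.exp (Complex.I * (∑ i, a i * Λ (A i) ω : ℝ)) := fun ω => by
    rw [← Complex.exp_sum]
    congr 1
    push_cast
    rw [Finset.mul_sum]
    exact Finset.sum_congr rfl fun i _ => by ring
  simp_rw [h2] at h1
  rw [h1, Finset.prod_congr rfl (fun i _ => hΛ.charFun_eq _ (hA i) (a i)), ← Complex.exp_sum]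
  congr 1
  simp_rw [apply_sum_indicator_of_disjoint hd hK]
  rw [integral_finsetSum]
  · refine Finset.sum_congr rfl fun i _ => ?_
    rw [integral_indicator_const _ (hS.measurableSet _ (hA i))]
    simp [Measure.real]
  · intro i _
    exact (integrable_indicator_iff (hS.measurableSet _ (hA i))).2
      (integrableOn_const (hS.measure_lt_top _ (hA i)).ne)

/-- The joint law of the values of `Λ` on a finite family of sets, which need not be disjoint. -/
lemma IsScatteredRandomMeasure.charFun_sum (hΛ : IsScatteredRandomMeasure P S μ K Λ)
    (hS : IsExhaustingDeltaRing S μ) (hK : K 0 = 0) {ι : Type*} [Fintype ι] {A : ι → Set Z}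
    (hA : ∀ i, A i ∈ S) (a : ι → ℝ) :
    ∫ ω, Complex.exp (Complex.I * (∑ i, a i * Λ (A i) ω : ℝ)) ∂P
      = Complex.exp (∫ z, K (∑ i, (A i).indicator (fun _ => a i) z) ∂μ) := by
  classical
  -- The atom of the empty index set is the complement of all the `A i`, which need not belong to
  -- the ring; there the sum of indicators is 0 and `hK` disposes of it.
  let κ := {σ : Finset ι // σ.Nonempty}
  let B : κ → Set Z := fun σ => familyAtom A σ.1
  have hB : ∀ σ, B σ ∈ S := fun σ => familyAtom_mem hS.isSetRing hA σ.2
  have hd : Pairwise (Function.onFun Disjoint B) := fun σ τ h =>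
    pairwise_disjoint_familyAtom A (fun h' => h (Subtype.ext h'))
  -- The constant value of Σ aᵢ 1_{Aᵢ} on the atom of σ.
  let b : κ → ℝ := fun σ => ∑ i ∈ σ.1, a i
  have hAB : ∀ i, A i = ⋃ σ ∈ (Finset.univ.filter fun σ : κ => i ∈ σ.1), B σ := fun i => by
    ext z
    simp only [Finset.mem_filter, Finset.mem_univ, true_and, Set.mem_iUnion]
    constructor
    · intro hz
      refine ⟨⟨Finset.univ.filter fun j => z ∈ A j, ⟨i, by simpa using hz⟩⟩, by simpa using hz, ?_⟩
      intro j; simp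
    · rintro ⟨σ, hi, hz⟩
      exact (hz i).2 hi
  have hsum : ∀ ω, (∀ i, Λ (A i) ω = ∑ σ ∈ (Finset.univ.filter fun σ : κ => i ∈ σ.1), Λ (B σ) ω) →
      ∑ i, a i * Λ (A i) ω = ∑ σ, b σ * Λ (B σ) ω := fun ω h => by
    simp_rw [h, b, Finset.mul_sum, Finset.sum_filter, Finset.sum_mul]
    rw [Finset.sum_comm]
    refine Finset.sum_congr rfl fun σ _ => ?_
    rw [← Finset.sum_filter]
    simp
  have hind : ∀ z, ∑ i, (A i).indicator (fun _ => a i) z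
      = ∑ σ, (B σ).indicator (fun _ => b σ) z := fun z => by
    by_cases h : ∃ i, z ∈ A i
    · set τ : κ := ⟨Finset.univ.filter fun j => z ∈ A j, h.imp fun i hi => by simpa using hi⟩
      have hτ : z ∈ B τ := fun j => by simp [τ]
      rw [Finset.sum_eq_single τ]
      · rw [Set.indicator_of_mem hτ]
        simp [b, τ, Finset.sum_filter, Set.indicator_apply]
      · intro σ _ hσ
        exact Set.indicator_of_notMem (fun hz => Set.disjoint_left.1 (hd hσ) hz hτ) _
      · simp
    · push Not at h
      rw [Finset.sum_eq_zero fun i _ => Set.indicator_of_notMem (h i) _,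
        Finset.sum_eq_zero fun σ _ => Set.indicator_of_notMem (fun hz => ?_) _]
      obtain ⟨i, hi⟩ := σ.2
      exact h i ((hz i).2 hi)
  have hae : ∀ᵐ ω ∂P, ∑ i, a i * Λ (A i) ω = ∑ σ, b σ * Λ (B σ) ω := by
    have : ∀ i, ∀ᵐ ω ∂P, Λ (A i) ω
        = ∑ σ ∈ (Finset.univ.filter fun σ : κ => i ∈ σ.1), Λ (B σ) ω := fun i => by
      conv => enter [1, ω, 1, 1]; rw [hAB i]
      exact hΛ.biUnion_ae_eq hS.isSetRing hB hd _
    filter_upwards [ae_all_iff.2 this] with ω hω using hsum ω hω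
  simp_rw [hind]
  rw [← hΛ.charFun_of_disjoint hS hK hB hd]
  refine integral_congr_ae ?_
  filter_upwards [hae] with ω hω
  rw [hω]

end RandomMeasure

/-! ### Second moments from characteristic functions. -/

section Moment

variable {Ω : Type*} [MeasurableSpace Ω] {P : Measure Ω} [IsProbabilityMeasure P]

lemma integrable_exp_I_mul {Y : Ω → ℝ} (hY : AEMeasurable Y P) :
    Integrable (fun ω => Complex.exp (Complex.I * (Y ω : ℂ))) P := by
  refine (integrable_const (1 : ℝ)).mono' (by fun_prop) (ae_of_all _ fun ω => ?_)
  rw [mul_comm, Complex.norm_exp_ofReal_mul_I]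

/-- A characteristic function which is `1 + O(s²)` belongs to a law with finite second moment. -/
lemma lintegral_sq_le_of_charFun {Y : Ω → ℝ} (hY : AEMeasurable Y P) {C : ℝ}
    (h : ∀ s : ℝ, ‖1 - ∫ ω, Complex.exp (Complex.I * ((s * Y ω : ℝ) : ℂ)) ∂P‖ ≤ C * s ^ 2) :
    ∫⁻ ω, ENNReal.ofReal (Y ω ^ 2) ∂P ≤ ENNReal.ofReal (2 * C) := by
  have hre : ∀ s : ℝ, ∫ ω, (1 - Real.cos (s * Y ω)) ∂P ≤ C * s ^ 2 := fun s => by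
    have hi := integrable_exp_I_mul (P := P) (hY.const_mul s)
    refine le_trans ?_ (h s)
    refine le_trans (le_of_eq ?_) (Complex.re_le_norm _)
    rw [Complex.sub_re, Complex.one_re, ← RCLike.re_eq_complex_re, ← integral_re hi,
      integral_sub (integrable_const _)]
    · simp only [integral_const, probReal_univ, smul_eq_mul, mul_one]
      congr 2
      ext ω
      rw [RCLike.re_eq_complex_re, mul_comm Complex.I, Complex.exp_ofReal_mul_I_re]
    · refine (integrable_const (1 : ℝ)).mono' (by fun_prop) (ae_of_all _ fun ω => ?_)
      exact Real.abs_cos_le_one _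
  -- As N → ∞, 2N²(1 - cos(y/N)) tends to y², and its expectation is at most 2C for every N by the
  -- hypothesis at s = 1/N. Fatou's lemma then bounds E Y². Here N = n + 1 avoids the division by
  -- zero.
  set f : ℕ → Ω → ENNReal := fun n ω =>
    ENNReal.ofReal (2 * ((n : ℝ) + 1) ^ 2 * (1 - Real.cos (((n : ℝ) + 1)⁻¹ * Y ω))) with hf
  have hlim : ∀ ω, Tendsto (fun n => f n ω) atTop (𝓝 (ENNReal.ofReal (Y ω ^ 2))) := fun ω => by
    refine ENNReal.tendsto_ofReal ?_
    have hn : Tendsto (fun n : ℕ => ((n : ℝ) + 1)⁻¹) atTop (𝓝 0) := by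
      simpa using tendsto_one_div_add_atTop_nhds_zero_nat (𝕜 := ℝ)
    have h2 : Tendsto (fun n : ℕ => Y ω ^ 2 * Real.sinc (((n : ℝ) + 1)⁻¹ * Y ω / 2) ^ 2) atTop
        (𝓝 (Y ω ^ 2)) := by
      have h3 : Tendsto (fun n : ℕ => ((n : ℝ) + 1)⁻¹ * Y ω / 2) atTop (𝓝 0) := by
        simpa using (hn.mul_const (Y ω)).div_const 2
      have := ((Real.continuous_sinc.tendsto 0).comp h3).pow 2 |>.const_mul (Y ω ^ 2)
      simpa using this
    refine h2.congr fun n => ?_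
    have hn0 : ((n : ℝ) + 1) ≠ 0 := by positivity
    by_cases hy : Y ω = 0
    · simp [hy]
    rw [Real.sinc_of_ne_zero (by positivity), div_pow]
    have : 1 - Real.cos (((n : ℝ) + 1)⁻¹ * Y ω)
        = 2 * Real.sin (((n : ℝ) + 1)⁻¹ * Y ω / 2) ^ 2 := by
      have := Real.cos_sq_add_sin_sq (((n : ℝ) + 1)⁻¹ * Y ω / 2)
      have h4 := Real.cos_two_mul (((n : ℝ) + 1)⁻¹ * Y ω / 2)
      rw [mul_div_cancel₀ _ two_ne_zero] at h4
      linarith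
    rw [this]
    field_simp
  have hmeas : ∀ n, AEMeasurable (f n) P := fun n => by
    refine AEMeasurable.ennreal_ofReal ?_
    fun_prop
  have hbd : ∀ n, ∫⁻ ω, f n ω ∂P ≤ ENNReal.ofReal (2 * C) := fun n => by
    have hi : Integrable (fun ω => 2 * ((n : ℝ) + 1) ^ 2
        * (1 - Real.cos (((n : ℝ) + 1)⁻¹ * Y ω))) P := by
      refine Integrable.const_mul ?_ _
      refine (integrable_const (2 : ℝ)).mono' (by fun_prop) (ae_of_all _ fun ω => ?_)
      rw [Real.norm_eq_abs, abs_le]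
      constructor <;> linarith [Real.cos_le_one (((n : ℝ) + 1)⁻¹ * Y ω),
        Real.neg_one_le_cos (((n : ℝ) + 1)⁻¹ * Y ω)]
    rw [← ofReal_integral_eq_lintegral_ofReal hi (ae_of_all _ fun ω => by
      have := Real.cos_le_one (((n : ℝ) + 1)⁻¹ * Y ω)
      have : 0 ≤ 1 - Real.cos (((n : ℝ) + 1)⁻¹ * Y ω) := by linarith
      simp only [Pi.zero_apply]; positivity)]
    refine ENNReal.ofReal_le_ofReal ?_
    rw [integral_const_mul]
    have := hre ((n : ℝ) + 1)⁻¹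
    have hn0 : (0 : ℝ) < (n : ℝ) + 1 := by positivity
    calc _ ≤ 2 * ((n : ℝ) + 1) ^ 2 * (C * (((n : ℝ) + 1)⁻¹) ^ 2) := by gcongr
      _ = 2 * C := by field_simp
  calc ∫⁻ ω, ENNReal.ofReal (Y ω ^ 2) ∂P = ∫⁻ ω, liminf (fun n => f n ω) atTop ∂P := by
        congr 1; ext ω; exact (hlim ω).liminf_eq.symm
    _ ≤ liminf (fun n => ∫⁻ ω, f n ω ∂P) atTop := lintegral_liminf_le' hmeas
    _ ≤ ENNReal.ofReal (2 * C) :=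
        liminf_le_of_frequently_le' (Frequently.of_forall hbd)

lemma memLp_two_of_charFun {Y : Ω → ℝ} (hY : AEMeasurable Y P) {C : ℝ}
    (h : ∀ s : ℝ, ‖1 - ∫ ω, Complex.exp (Complex.I * ((s * Y ω : ℝ) : ℂ)) ∂P‖ ≤ C * s ^ 2) :
    MemLp Y 2 P := by
  rw [memLp_two_iff_integrable_sq hY.aestronglyMeasurable]
  refine ⟨by fun_prop, ?_⟩
  rw [hasFiniteIntegral_iff_ofReal (ae_of_all _ fun ω => sq_nonneg _)]
  exact (lintegral_sq_le_of_charFun hY h).trans_lt ENNReal.ofReal_lt_top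

end Moment

/-! ### The stochastic integral as a closed subspace of L²(μ) × L²(P). -/

section Chaos

variable {Z Ω : Type*} [MeasurableSpace Z] [MeasurableSpace Ω]
  {P : Measure Ω} [IsProbabilityMeasure P] {S : Set (Set Z)} {μ : Measure Z}
  {Λ : Set Z → Ω → ℝ} {b : ℝ} {W : Measure ℝ}

lemma integrable_sq_Lp (g : Lp ℝ 2 μ) : Integrable (fun z => g z ^ 2) μ :=
  (memLp_two_iff_integrable_sq (Lp.aestronglyMeasurable g)).1 (Lp.memLp g)

lemma norm_sq_Lp (g : Lp ℝ 2 μ) : ‖g‖ ^ 2 = ∫ z, g z ^ 2 ∂μ := by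
  rw [← real_inner_self_eq_norm_sq, L2.inner_def]
  simp [sq]

lemma integral_abs_mul_abs_le (g h : Lp ℝ 2 μ) : ∫ z, |g z| * |h z| ∂μ ≤ ‖g‖ * ‖h‖ := by
  have h1 := real_inner_le_norm |g| |h|
  rw [norm_abs_eq_norm, norm_abs_eq_norm, L2.inner_def] at h1
  refine (le_of_eq (integral_congr_ae ?_)).trans h1
  filter_upwards [Lp.coeFn_abs g, Lp.coeFn_abs h] with z h2 h3
  simp [h2, h3, mul_comm]

lemma integrable_abs_mul_abs (g h : Lp ℝ 2 μ) : Integrable (fun z => |g z| * |h z|) μ :=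
  MemLp.integrable_mul (Lp.memLp g).abs (Lp.memLp h).abs

lemma integrable_cumulantFn_comp (hb : 0 ≤ b) (hW2 : Integrable (fun x : ℝ => x ^ 2) W)
    {g : Z → ℝ} (hg : AEStronglyMeasurable g μ) (hg2 : Integrable (fun z => g z ^ 2) μ) :
    Integrable (fun z => cumulantFn 0 b W (g z)) μ :=
  (hg2.const_mul (levyVariance b W)).mono'
    ((continuous_cumulantFn hW2).comp_aestronglyMeasurable hg)
    (ae_of_all _ fun z => norm_cumulantFn_le hb hW2 (g z))

lemma continuous_integral_cumulantFn (hb : 0 ≤ b) (hW2 : Integrable (fun x : ℝ => x ^ 2) W) :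
    Continuous (fun g : Lp ℝ 2 μ => ∫ z, cumulantFn 0 b W (g z) ∂μ) := by
  have hσ : 0 ≤ levyVariance b W := levyVariance_nonneg hb
  have key : ∀ g h : Lp ℝ 2 μ, ‖(∫ z, cumulantFn 0 b W (h z) ∂μ) - ∫ z, cumulantFn 0 b W (g z) ∂μ‖
      ≤ levyVariance b W * (‖h‖ + ‖g‖) * ‖h - g‖ := fun g h => by
    rw [← integral_sub
      (integrable_cumulantFn_comp hb hW2 (Lp.aestronglyMeasurable h) (integrable_sq_Lp h))
      (integrable_cumulantFn_comp hb hW2 (Lp.aestronglyMeasurable g) (integrable_sq_Lp g))]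
    have hi := ((integrable_abs_mul_abs h (h - g)).add
      (integrable_abs_mul_abs g (h - g))).const_mul (levyVariance b W)
    refine (norm_integral_le_of_norm_le hi ?_).trans ?_
    · filter_upwards [Lp.coeFn_sub h g] with z hz
      refine (norm_cumulantFn_sub_le hb hW2 _ _).trans (le_of_eq ?_)
      simp only [Pi.add_apply, hz, Pi.sub_apply]
      ring
    · simp only [Pi.add_apply]
      rw [integral_const_mul, integral_add (integrable_abs_mul_abs _ _)
        (integrable_abs_mul_abs _ _), mul_assoc]
      refine mul_le_mul_of_nonneg_left ?_ hσ
      linarith [integral_abs_mul_abs_le h (h - g), integral_abs_mul_abs_le g (h - g)]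
  refine continuous_iff_continuousAt.2 fun g => ?_
  rw [ContinuousAt, tendsto_iff_norm_sub_tendsto_zero]
  refine squeeze_zero (fun _ => norm_nonneg _) (key g) ?_
  have : Continuous fun h : Lp ℝ 2 μ => levyVariance b W * (‖h‖ + ‖g‖) * ‖h - g‖ := by fun_prop
  simpa using this.tendsto g

lemma norm_exp_I_sub_exp_I_le (x y : ℝ) :
    ‖Complex.exp (Complex.I * x) - Complex.exp (Complex.I * y)‖ ≤ |x - y| := by
  have h : Complex.exp (Complex.I * x) - Complex.exp (Complex.I * y)
      = Complex.exp (y * Complex.I) * (Complex.exp (Complex.I * ((x - y : ℝ) : ℂ)) - 1) := by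
    rw [mul_sub, ← Complex.exp_add, mul_one, mul_comm (y : ℂ)]
    congr 2
    push_cast; ring
  rw [h, norm_mul, Complex.norm_exp_ofReal_mul_I, one_mul]
  exact Real.norm_exp_I_mul_ofReal_sub_one_le

lemma continuous_integral_exp_I_mul :
    Continuous (fun Y : Lp ℝ 2 P => ∫ ω, Complex.exp (Complex.I * (Y ω : ℂ)) ∂P) := by
  have hm : ∀ Y : Lp ℝ 2 P, AEMeasurable Y P := fun Y => (Lp.aestronglyMeasurable Y).aemeasurable
  have hint : ∀ Y : Lp ℝ 2 P, Integrable Y P := fun Y => (Lp.memLp Y).integrable (by norm_num)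
  refine continuous_iff_continuousAt.2 fun g => ?_
  rw [ContinuousAt, tendsto_iff_norm_sub_tendsto_zero]
  have h1 : Continuous fun Y : Lp ℝ 2 P => ‖Y - g‖ * ‖Lp.const 2 P (1 : ℝ)‖ := by fun_prop
  have h0 := h1.tendsto g
  simp only [sub_self, norm_zero, zero_mul] at h0
  refine squeeze_zero (fun _ => norm_nonneg _) (fun Y => ?_) h0
  rw [← integral_sub (integrable_exp_I_mul (hm Y)) (integrable_exp_I_mul (hm g))]
  refine (norm_integral_le_of_norm_le (integrable_abs_mul_abs (Y - g) (Lp.const 2 P (1 : ℝ))) ?_).trans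
    (integral_abs_mul_abs_le _ _)
  filter_upwards [Lp.coeFn_sub Y g, Lp.coeFn_const (p := 2) (μ := P) (1 : ℝ)] with ω h2 h3
  rw [h2, h3]
  simpa using norm_exp_I_sub_exp_I_le (Y ω) (g ω)

variable (P S μ Λ) in
/-- The closed linear span, in `L²(μ) × L²(P)`, of the pairs `(1_A, Λ(A))`, `A ∈ S`: the graph of
the stochastic integral with respect to `Λ`. -/
def integralGraph : Submodule ℝ (Lp ℝ 2 μ × Lp ℝ 2 P) :=
  (Submodule.span ℝ {p : Lp ℝ 2 μ × Lp ℝ 2 P | ∃ A ∈ S,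
    p.1 =ᵐ[μ] A.indicator (fun _ => (1 : ℝ)) ∧ p.2 =ᵐ[P] Λ A}).topologicalClosure

/-- The Rajput–Rosiński formula for the characteristic function of a stochastic integral. -/
lemma charFun_of_mem_integralGraph (hb : 0 ≤ b) (hW2 : Integrable (fun x : ℝ => x ^ 2) W)
    (hS : IsExhaustingDeltaRing S μ)
    (hΛ : IsScatteredRandomMeasure P S μ (cumulantFn 0 b W) Λ)
    {p : Lp ℝ 2 μ × Lp ℝ 2 P} (hp : p ∈ integralGraph P S μ Λ) :
    ∫ ω, Complex.exp (Complex.I * (p.2 ω : ℂ)) ∂P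
      = Complex.exp (∫ z, cumulantFn 0 b W (p.1 z) ∂μ) := by
  -- Both sides are continuous on L² × L², so it is enough to check the identity on the span, where
  -- it is `charFun_sum`.
  have hclosed : IsClosed {p : Lp ℝ 2 μ × Lp ℝ 2 P |
      ∫ ω, Complex.exp (Complex.I * (p.2 ω : ℂ)) ∂P
        = Complex.exp (∫ z, cumulantFn 0 b W (p.1 z) ∂μ)} :=
    isClosed_eq (continuous_integral_exp_I_mul.comp continuous_snd)
      (Complex.continuous_exp.comp ((continuous_integral_cumulantFn hb hW2).comp continuous_fst))
  refine closure_minimal ?_ hclosed hp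
  intro q hq
  obtain ⟨n, a, f, rfl⟩ := Submodule.mem_span_set'.1 hq
  choose A hA h1 h2 using fun i => (f i).2
  have e1 : (∑ i, a i • (f i : Lp ℝ 2 μ × Lp ℝ 2 P)).1
      =ᵐ[μ] fun z => ∑ i, (A i).indicator (fun _ => a i) z := by
    rw [Prod.fst_sum]
    refine (Lp.coeFn_finsetSum _ _).trans ?_
    have h3 : ∀ i, ∀ᵐ z ∂μ, (a i • (f i : Lp ℝ 2 μ × Lp ℝ 2 P)).1 z
        = (A i).indicator (fun _ => a i) z := fun i => by
      rw [Prod.smul_fst]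
      filter_upwards [Lp.coeFn_smul (a i) (f i : Lp ℝ 2 μ × Lp ℝ 2 P).1, h1 i] with z h4 h5
      rw [h4, Pi.smul_apply, h5]
      by_cases hz : z ∈ A i <;> simp [hz]
    filter_upwards [ae_all_iff.2 h3] with z hz
    rw [Finset.sum_apply]
    exact Finset.sum_congr rfl fun i _ => hz i
  have e2 : (∑ i, a i • (f i : Lp ℝ 2 μ × Lp ℝ 2 P)).2
      =ᵐ[P] fun ω => ∑ i, a i * Λ (A i) ω := by
    rw [Prod.snd_sum]
    refine (Lp.coeFn_finsetSum _ _).trans ?_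
    have h3 : ∀ i, ∀ᵐ ω ∂P, (a i • (f i : Lp ℝ 2 μ × Lp ℝ 2 P)).2 ω = a i * Λ (A i) ω := fun i => by
      rw [Prod.smul_snd]
      filter_upwards [Lp.coeFn_smul (a i) (f i : Lp ℝ 2 μ × Lp ℝ 2 P).2, h2 i] with z h4 h5
      rw [h4, Pi.smul_apply, h5, smul_eq_mul]
    filter_upwards [ae_all_iff.2 h3] with z hz
    rw [Finset.sum_apply]
    exact Finset.sum_congr rfl fun i _ => hz i
  have := hΛ.charFun_sum hS cumulantFn_zero hA a
  rw [Set.mem_ofPred_eq, integral_congr_ae (g := fun ω => Complex.exp (Complex.I *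
      (∑ i, a i * Λ (A i) ω : ℝ))) (by filter_upwards [e2] with ω h; rw [h]), this,
    integral_congr_ae]
  filter_upwards [e1] with z h
  rw [h]

lemma norm_one_sub_exp_le {w : ℂ} (hw : w.re ≤ 0) : ‖1 - Complex.exp w‖ ≤ 2 * ‖w‖ := by
  rw [norm_sub_rev]
  rcases le_or_gt ‖w‖ 1 with h | h
  · exact Complex.norm_exp_sub_one_le h
  · refine (norm_sub_le _ _).trans ?_
    rw [Complex.norm_exp, norm_one]
    linarith [Real.exp_le_one_iff.2 hw]

lemma re_integral_cumulantFn_le (hb : 0 ≤ b) (hW2 : Integrable (fun x : ℝ => x ^ 2) W)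
    (g : Lp ℝ 2 μ) : (∫ z, cumulantFn 0 b W (g z) ∂μ).re ≤ -(b / 2) * ‖g‖ ^ 2 := by
  have hi := integrable_cumulantFn_comp hb hW2 (Lp.aestronglyMeasurable g) (integrable_sq_Lp g)
  rw [← RCLike.re_eq_complex_re, ← integral_re hi, norm_sq_Lp, ← integral_const_mul]
  exact integral_mono hi.re ((integrable_sq_Lp g).const_mul _) fun z => re_cumulantFn_le hW2 (g z)

lemma norm_integral_cumulantFn_le (hb : 0 ≤ b) (hW2 : Integrable (fun x : ℝ => x ^ 2) W)
    (g : Lp ℝ 2 μ) : ‖∫ z, cumulantFn 0 b W (g z) ∂μ‖ ≤ levyVariance b W * ‖g‖ ^ 2 := by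
  rw [norm_sq_Lp, ← integral_const_mul]
  exact norm_integral_le_of_norm_le ((integrable_sq_Lp g).const_mul _)
    (ae_of_all _ fun z => norm_cumulantFn_le hb hW2 (g z))

/-- The exact formula at s • p gives 1 - E exp(isY) = O(s²) with constant 2σ²‖g‖², hence a second
moment bound. The factor 4 is not sharp, but only boundedness of g ↦ Y matters. -/
lemma norm_snd_sq_le_of_mem_integralGraph (hb : 0 ≤ b) (hW2 : Integrable (fun x : ℝ => x ^ 2) W)
    (hS : IsExhaustingDeltaRing S μ)
    (hΛ : IsScatteredRandomMeasure P S μ (cumulantFn 0 b W) Λ)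
    {p : Lp ℝ 2 μ × Lp ℝ 2 P} (hp : p ∈ integralGraph P S μ Λ) :
    ‖p.2‖ ^ 2 ≤ 4 * levyVariance b W * ‖p.1‖ ^ 2 := by
  have h := lintegral_sq_le_of_charFun (Y := p.2) (P := P)
    (Lp.aestronglyMeasurable _).aemeasurable (C := 2 * levyVariance b W * ‖p.1‖ ^ 2) fun s => by
    have hs := charFun_of_mem_integralGraph hb hW2 hS hΛ (Submodule.smul_mem _ s hp)
    have e : ∫ ω, Complex.exp (Complex.I * ((s * p.2 ω : ℝ) : ℂ)) ∂P
        = ∫ ω, Complex.exp (Complex.I * ((s • p).2 ω : ℂ)) ∂P := by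
      refine integral_congr_ae ?_
      rw [Prod.smul_snd]
      filter_upwards [Lp.coeFn_smul s p.2] with ω hω
      rw [hω, Pi.smul_apply, smul_eq_mul]
    rw [e, hs]
    refine (norm_one_sub_exp_le ?_).trans ?_
    · refine (re_integral_cumulantFn_le hb hW2 _).trans ?_
      nlinarith [sq_nonneg ‖(s • p).1‖]
    · have := norm_integral_cumulantFn_le hb hW2 (s • p).1
      rw [Prod.smul_fst, norm_smul, mul_pow, Real.norm_eq_abs, sq_abs] at this
      rw [Prod.smul_fst]
      linarith
  have hσ : 0 ≤ levyVariance b W := levyVariance_nonneg hb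
  rw [← ofReal_integral_eq_lintegral_ofReal (integrable_sq_Lp p.2)
    (ae_of_all _ fun _ => sq_nonneg _), ← norm_sq_Lp,
    ENNReal.ofReal_le_ofReal_iff (by positivity)] at h
  linarith

/-- When b > 0 this controls the integrand by the law of its integral: a characteristic function
close to 1 forces ‖g‖ to be small. -/
lemma norm_charFun_le_of_mem_integralGraph (hb : 0 ≤ b)
    (hW2 : Integrable (fun x : ℝ => x ^ 2) W) (hS : IsExhaustingDeltaRing S μ)
    (hΛ : IsScatteredRandomMeasure P S μ (cumulantFn 0 b W) Λ)
    {p : Lp ℝ 2 μ × Lp ℝ 2 P} (hp : p ∈ integralGraph P S μ Λ) :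
    ‖∫ ω, Complex.exp (Complex.I * (p.2 ω : ℂ)) ∂P‖ ≤ Real.exp (-(b / 2) * ‖p.1‖ ^ 2) := by
  rw [charFun_of_mem_integralGraph hb hW2 hS hΛ hp, Complex.norm_exp]
  exact Real.exp_le_exp.2 (re_integral_cumulantFn_le hb hW2 _)

lemma IsScatteredRandomMeasure.memLp (hb : 0 ≤ b) (hW2 : Integrable (fun x : ℝ => x ^ 2) W)
    (hΛ : IsScatteredRandomMeasure P S μ (cumulantFn 0 b W) Λ) {A : Set Z} (hA : A ∈ S) :
    MemLp (Λ A) 2 P := by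
  refine memLp_two_of_charFun (hΛ.aemeasurable A hA)
    (C := 2 * ((μ A).toReal * levyVariance b W)) fun s => ?_
  have h := hΛ.charFun_eq A hA s
  simp only [Complex.ofReal_mul, ← mul_assoc] at h ⊢
  rw [h]
  have hre : (((μ A).toReal : ℂ) * cumulantFn 0 b W s).re ≤ 0 := by
    rw [Complex.re_ofReal_mul]
    have := re_cumulantFn_le (b := b) hW2 s
    exact mul_nonpos_of_nonneg_of_nonpos ENNReal.toReal_nonneg
      (this.trans (by nlinarith [sq_nonneg s]))
  refine (norm_one_sub_exp_le hre).trans ?_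
  rw [norm_mul, Complex.norm_real, Real.norm_eq_abs, abs_of_nonneg ENNReal.toReal_nonneg]
  have := mul_le_mul_of_nonneg_left (norm_cumulantFn_le hb hW2 s)
    (ENNReal.toReal_nonneg (a := μ A))
  nlinarith

lemma SimpleFn.exists_mem_integralGraph (hb : 0 ≤ b) (hW2 : Integrable (fun x : ℝ => x ^ 2) W)
    (hS : IsExhaustingDeltaRing S μ)
    (hΛ : IsScatteredRandomMeasure P S μ (cumulantFn 0 b W) Λ) (φ : SimpleFn S) :
    ∃ p ∈ integralGraph P S μ Λ, p.1 =ᵐ[μ] φ.eval ∧ p.2 =ᵐ[P] φ.integral Λ Set.univ := by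
  have h : ∀ i, ∃ q ∈ integralGraph P S μ Λ,
      q.1 =ᵐ[μ] (φ.sets i).indicator (fun _ => (1 : ℝ)) ∧ q.2 =ᵐ[P] Λ (φ.sets i) := fun i => by
    have hA := φ.sets_mem i
    have hΛA := hΛ.memLp hb hW2 hA
    have h1 := indicatorConstLp_coeFn (p := 2) (hs := hS.measurableSet _ hA)
      (hμs := (hS.measure_lt_top _ hA).ne) (c := (1 : ℝ))
    exact ⟨(_, hΛA.toLp), Submodule.le_topologicalClosure _
      (Submodule.subset_span ⟨_, hA, h1, hΛA.coeFn_toLp⟩), h1, hΛA.coeFn_toLp⟩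
  choose q hq h1 h2 using h
  refine ⟨∑ i, φ.coef i • q i, Submodule.sum_mem _ fun i _ => Submodule.smul_mem _ _ (hq i), ?_, ?_⟩
  · rw [Prod.fst_sum]
    refine (Lp.coeFn_finsetSum _ _).trans ?_
    have h3 : ∀ i, ∀ᵐ z ∂μ, (φ.coef i • q i).1 z
        = (φ.sets i).indicator (fun _ => φ.coef i) z := fun i => by
      rw [Prod.smul_fst]
      filter_upwards [Lp.coeFn_smul (φ.coef i) (q i).1, h1 i] with z h4 h5
      rw [h4, Pi.smul_apply, h5]
      by_cases hz : z ∈ φ.sets i <;> simp [hz]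
    filter_upwards [ae_all_iff.2 h3] with z hz
    rw [Finset.sum_apply]
    exact Finset.sum_congr rfl fun i _ => hz i
  · rw [Prod.snd_sum]
    refine (Lp.coeFn_finsetSum _ _).trans ?_
    have h3 : ∀ i, ∀ᵐ ω ∂P, (φ.coef i • q i).2 ω = φ.coef i * Λ (φ.sets i) ω := fun i => by
      rw [Prod.smul_snd]
      filter_upwards [Lp.coeFn_smul (φ.coef i) (q i).2, h2 i] with z h4 h5
      rw [h4, Pi.smul_apply, h5, smul_eq_mul]
    filter_upwards [ae_all_iff.2 h3] with z hz
    rw [Finset.sum_apply]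
    simp only [SimpleFn.integral, Set.inter_univ]
    exact Finset.sum_congr rfl fun i _ => hz i

lemma tendsto_integral_norm_exp_I_sub {Y : ℕ → Ω → ℝ} {ξ : Ω → ℝ}
    (hY : ∀ n, AEMeasurable (Y n) P) (hξ : AEMeasurable ξ P)
    (h : TendstoInMeasure P Y atTop ξ) :
    Tendsto (fun n => ∫ ω, ‖Complex.exp (Complex.I * Y n ω) - Complex.exp (Complex.I * ξ ω)‖ ∂P)
      atTop (𝓝 0) := by
  refine tendsto_of_subseq_tendsto fun ns hns => ?_
  obtain ⟨ms, -, hms⟩ := (h.comp hns).exists_seq_tendsto_ae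
  refine ⟨ms, ?_⟩
  have : (0 : ℝ) = ∫ _, (0 : ℝ) ∂P := by simp
  rw [this]
  refine tendsto_integral_of_dominated_convergence (fun _ => 2) (fun n => ?_)
    (integrable_const _) (fun n => ae_of_all _ fun ω => ?_) ?_
  · have := hY (ns (ms n))
    exact AEMeasurable.aestronglyMeasurable (by fun_prop)
  · rw [norm_norm]
    refine (norm_sub_le _ _).trans ?_
    rw [mul_comm, Complex.norm_exp_ofReal_mul_I, mul_comm, Complex.norm_exp_ofReal_mul_I]
    norm_num
  · filter_upwards [hms] with ω hω
    have hc : Continuous fun x : ℝ =>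
        ‖Complex.exp (Complex.I * x) - Complex.exp (Complex.I * ξ ω)‖ := by fun_prop
    simpa [Function.comp_def] using (hc.tendsto (ξ ω)).comp hω

/-- A Rajput–Rosiński integral is an `L²` limit of integrals of simple functions as soon as the
random measure has a Gaussian component. -/
lemma IsRandomIntegral.exists_mem_integralGraph (hb : 0 < b)
    (hW2 : Integrable (fun x : ℝ => x ^ 2) W) (hS : IsExhaustingDeltaRing S μ)
    (hΛ : IsScatteredRandomMeasure P S μ (cumulantFn 0 b W) Λ) {f : Z → ℝ} {ξ : Ω → ℝ}
    (h : IsRandomIntegral P S μ Λ f ξ) :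
    ∃ p ∈ integralGraph P S μ Λ, p.1 =ᵐ[μ] f ∧ p.2 =ᵐ[P] ξ := by
  obtain ⟨φ, hφ, -, hξ, hlim⟩ := h
  choose p hp h1 h2 using fun n => (φ n).exists_mem_integralGraph hb.le hW2 hS hΛ
  have hlim' : TendstoInMeasure P (fun n => (p n).2) atTop ξ :=
    hlim.congr_left fun n => (h2 n).symm
  have hm : ∀ n, AEMeasurable (p n).2 P := fun n => (Lp.aestronglyMeasurable _).aemeasurable
  set a : ℕ → ℝ := fun n =>
    ∫ ω, ‖Complex.exp (Complex.I * (p n).2 ω) - Complex.exp (Complex.I * ξ ω)‖ ∂P with ha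
  have ha0 : Tendsto a atTop (𝓝 0) := tendsto_integral_norm_exp_I_sub hm hξ hlim'
  have hint : ∀ n, Integrable (fun ω =>
      ‖Complex.exp (Complex.I * (p n).2 ω) - Complex.exp (Complex.I * ξ ω)‖) P := fun n =>
    ((integrable_exp_I_mul (hm n)).sub (integrable_exp_I_mul hξ)).norm
  -- The characteristic function of the difference of two integrals is within `a n + a m` of 1,
  -- because both are close to ξ in probability; the Gaussian decay bounds it from above by the
  -- right-hand side.
  have hsub : ∀ n m, 1 - (a n + a m) ≤ Real.exp (-(b / 2) * ‖(p n).1 - (p m).1‖ ^ 2) := by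
    intro n m
    have h3 := norm_charFun_le_of_mem_integralGraph hb.le hW2 hS hΛ
      (Submodule.sub_mem _ (hp n) (hp m))
    rw [Prod.fst_sub] at h3
    refine le_trans ?_ h3
    have h4 : ‖1 - ∫ ω, Complex.exp (Complex.I * ((p n - p m).2 ω : ℂ)) ∂P‖ ≤ a n + a m := by
      have hi : Integrable (fun ω => Complex.exp (Complex.I * ((p n - p m).2 ω : ℂ))) P :=
        integrable_exp_I_mul (Lp.aestronglyMeasurable _).aemeasurable
      have e : (1 : ℂ) = ∫ _, (1 : ℂ) ∂P := by simp
      rw [e, ← integral_sub (integrable_const _) hi, ha]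
      simp only
      rw [← integral_add (hint n) (hint m)]
      refine norm_integral_le_of_norm_le ((hint n).add (hint m)) ?_
      rw [Prod.snd_sub]
      filter_upwards [Lp.coeFn_sub (p n).2 (p m).2] with ω hω
      rw [hω, Pi.sub_apply]
      set x := (p n).2 ω
      set y := (p m).2 ω
      have e2 : 1 - Complex.exp (Complex.I * ((x - y : ℝ) : ℂ))
          = Complex.exp ((-y : ℝ) * Complex.I) *
            (Complex.exp (Complex.I * y) - Complex.exp (Complex.I * x)) := by
        rw [mul_sub, ← Complex.exp_add, ← Complex.exp_add]
        congr 1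
        · rw [show ((-y : ℝ) : ℂ) * Complex.I + Complex.I * y = 0 by push_cast; ring,
            Complex.exp_zero]
        · congr 1; push_cast; ring
      rw [e2, norm_mul, Complex.norm_exp_ofReal_mul_I, one_mul, norm_sub_rev]
      calc _ ≤ ‖Complex.exp (Complex.I * x) - Complex.exp (Complex.I * ξ ω)‖
            + ‖Complex.exp (Complex.I * ξ ω) - Complex.exp (Complex.I * y)‖ := norm_sub_le_norm_sub_add_norm_sub _ _ _
        _ = _ := by rw [norm_sub_rev (Complex.exp (Complex.I * ξ ω))]
    have h5 := norm_sub_norm_le (1 : ℂ) (∫ ω, Complex.exp (Complex.I * ((p n - p m).2 ω : ℂ)) ∂P)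
    rw [norm_one] at h5
    linarith
  have hσ := levyVariance_pos (W := W) hb
  have hc1 : CauchySeq fun n => (p n).1 := by
    refine Metric.cauchySeq_iff.2 fun ε hε => ?_
    -- Integrands at distance at least ε would keep the characteristic function of the difference at
    -- least δ away from 1.
    set δ : ℝ := 1 - Real.exp (-(b / 2) * ε ^ 2)
    have hδ : 0 < δ := by
      have : Real.exp (-(b / 2) * ε ^ 2) < 1 := Real.exp_lt_one_iff.2 (by nlinarith [mul_pos hb (pow_pos hε 2)])
      simp only [δ]; linarith
    obtain ⟨N, hN⟩ := eventually_atTop.1 (ha0.eventually_lt_const (half_pos hδ))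
    refine ⟨N, fun m hm n hn => ?_⟩
    have h6 := hsub m n
    have h7 : Real.exp (-(b / 2) * ε ^ 2) < Real.exp (-(b / 2) * ‖(p m).1 - (p n).1‖ ^ 2) := by
      have := hN m hm
      have := hN n hn
      simp only [δ] at *
      linarith
    rw [Real.exp_lt_exp] at h7
    rw [dist_eq_norm]
    refine lt_of_pow_lt_pow_left₀ 2 hε.le ?_
    nlinarith
  have hc2 : CauchySeq fun n => (p n).2 := by
    refine Metric.cauchySeq_iff.2 fun ε hε => ?_
    set M : ℝ := 4 * levyVariance b W with hM
    have hM0 : 0 < M := by positivity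
    obtain ⟨N, hN⟩ := Metric.cauchySeq_iff.1 hc1 (ε / √M) (by positivity)
    refine ⟨N, fun m hm n hn => ?_⟩
    have h3 := norm_snd_sq_le_of_mem_integralGraph hb.le hW2 hS hΛ
      (Submodule.sub_mem _ (hp m) (hp n))
    have h4 := hN m hm n hn
    rw [dist_eq_norm] at h4 ⊢
    rw [Prod.fst_sub, Prod.snd_sub] at h3
    refine lt_of_pow_lt_pow_left₀ 2 hε.le (h3.trans_lt ?_)
    rw [lt_div_iff₀ (Real.sqrt_pos.2 hM0)] at h4
    calc M * ‖(p m).1 - (p n).1‖ ^ 2 = (‖(p m).1 - (p n).1‖ * √M) ^ 2 := by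
          rw [mul_pow, Real.sq_sqrt hM0.le]; ring
      _ < ε ^ 2 := pow_lt_pow_left₀ h4 (by positivity) two_ne_zero
  obtain ⟨q, hq⟩ := cauchySeq_tendsto_of_complete (hc1.prodMk hc2)
  have hq1 : Tendsto (fun n => (p n).1) atTop (𝓝 q.1) := (continuous_fst.tendsto q).comp hq
  have hq2 : Tendsto (fun n => (p n).2) atTop (𝓝 q.2) := (continuous_snd.tendsto q).comp hq
  refine ⟨q, ?_, ?_, ?_⟩
  · exact (Submodule.isClosed_topologicalClosure _).mem_of_tendsto hq (Eventually.of_forall hp)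
  -- The simple functions converge to f almost everywhere, and along a subsequence also to the L²
  -- limit, so the two agree; in particular f is square integrable.
  · obtain ⟨ns, hns, hae⟩ := (tendstoInMeasure_of_tendsto_Lp hq1).exists_seq_tendsto_ae
    filter_upwards [hae, hφ, ae_all_iff.2 h1] with z h3 h4 h5
    refine tendsto_nhds_unique h3 ?_
    simp_rw [h5]
    exact h4.comp hns.tendsto_atTop
  · exact tendstoInMeasure_ae_unique (tendstoInMeasure_of_tendsto_Lp hq2) hlim'

end Chaos

/-! ### Bochner integrals in L² versus pointwise integrals. -/

section LpValuedIntegral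

variable {α β : Type*} [MeasurableSpace α] [MeasurableSpace β] {ν : Measure α} [SFinite ν]
  {ρ : Measure β}

lemma setIntegral_abs_le (g : Lp ℝ 2 ρ) {A : Set β} (hA : MeasurableSet A) (hρA : ρ A ≠ ⊤) :
    ∫ z in A, |g z| ∂ρ ≤ ‖indicatorConstLp 2 hA hρA (1 : ℝ)‖ * ‖g‖ := by
  have h := real_inner_le_norm (indicatorConstLp 2 hA hρA (1 : ℝ)) |g|
  rw [norm_abs_eq_norm, L2.inner_indicatorConstLp_one] at h
  refine le_trans (le_of_eq (integral_congr_ae ?_)) h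
  filter_upwards [ae_restrict_of_ae (s := A) (Lp.coeFn_abs g)] with z hz
  exact hz.symm

variable [SigmaFinite ρ]

/-- On a set A of finite measure the L¹ norm is at most a constant times the L² norm, so
integrability of y ↦ ‖G y‖ yields joint integrability and opens the way to Fubini over A. -/
lemma integrable_prod_restrict_of_Lp {F : α → β → ℝ}
    (hF : AEStronglyMeasurable (Function.uncurry F) (ν.prod ρ)) {G : α → Lp ℝ 2 ρ}
    (hG : Integrable G ν) (hFG : ∀ᵐ y ∂ν, G y =ᵐ[ρ] F y) {A : Set β} (hA : MeasurableSet A)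
    (hρA : ρ A < ⊤) : Integrable (Function.uncurry F) (ν.prod (ρ.restrict A)) := by
  have hF' : AEStronglyMeasurable (Function.uncurry F) (ν.prod (ρ.restrict A)) := by
    have h : ν.prod (ρ.restrict A) = (ν.prod ρ).restrict (Set.univ ×ˢ A) := by
      rw [← Measure.prod_restrict, Measure.restrict_univ]
    rw [h]
    exact hF.restrict
  have : IsFiniteMeasure (ρ.restrict A) := ⟨by simpa using hρA⟩
  rw [integrable_prod_iff hF']
  refine ⟨?_, ?_⟩
  · filter_upwards [hFG] with y hy
    have h : MemLp (F y) 2 (ρ.restrict A) := ((Lp.memLp (G y)).ae_eq hy).restrict A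
    exact h.integrable (by norm_num)
  · refine (hG.norm.const_mul ‖indicatorConstLp 2 hA hρA.ne (1 : ℝ)‖).mono'
      hF'.norm.integral_prod_right' ?_
    filter_upwards [hFG] with y hy
    rw [Real.norm_of_nonneg (integral_nonneg fun _ => norm_nonneg _)]
    refine le_trans (le_of_eq (integral_congr_ae ?_)) (setIntegral_abs_le (G y) hA hρA.ne)
    filter_upwards [ae_restrict_of_ae (s := A) hy] with z hz
    rw [hz]
    rfl

lemma ae_integrable_of_Lp {F : α → β → ℝ}
    (hF : AEStronglyMeasurable (Function.uncurry F) (ν.prod ρ)) {G : α → Lp ℝ 2 ρ}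
    (hG : Integrable G ν) (hFG : ∀ᵐ y ∂ν, G y =ᵐ[ρ] F y) :
    ∀ᵐ z ∂ρ, Integrable (fun y => F y z) ν := by
  refine ae_of_forall_measure_lt_top_ae_restrict _ fun A hA hρA => ?_
  exact (integrable_prod_restrict_of_Lp hF hG hFG hA hρA).prod_left_ae

/-- The Bochner integral of an `L²`-valued function agrees with the pointwise integral. -/
lemma coeFn_integral_Lp {F : α → β → ℝ}
    (hF : AEStronglyMeasurable (Function.uncurry F) (ν.prod ρ)) {G : α → Lp ℝ 2 ρ}
    (hG : Integrable G ν) (hFG : ∀ᵐ y ∂ν, G y =ᵐ[ρ] F y) :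
    ⇑(∫ y, G y ∂ν) =ᵐ[ρ] fun z => ∫ y, F y z ∂ν := by
  refine ae_eq_of_forall_setIntegral_eq_of_sigmaFinite (fun A hA hρA => ?_) (fun A hA hρA => ?_)
    (fun A hA hρA => ?_)
  · have : IsFiniteMeasure (ρ.restrict A) := ⟨by simpa using hρA⟩
    exact ((Lp.memLp _).restrict A).integrable (by norm_num)
  · exact (integrable_prod_restrict_of_Lp hF hG hFG hA hρA).integral_prod_right
  -- Integration over A is the inner product with 1_A, a continuous functional that commutes with
  -- the Bochner integral; Fubini treats the pointwise integral.
  · rw [← L2.inner_indicatorConstLp_one (𝕜 := ℝ) hA hρA.ne,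
      integral_integral_swap (f := fun z y => F y z)
        (integrable_prod_restrict_of_Lp hF hG hFG hA hρA).swap,
      ← innerSL_apply_apply ℝ, ← ContinuousLinearMap.integral_comp_comm _ hG]
    refine integral_congr_ae ?_
    filter_upwards [hFG] with y hy
    rw [innerSL_apply_apply, L2.inner_indicatorConstLp_one]
    exact integral_congr_ae (ae_restrict_of_ae hy)

end LpValuedIntegral

lemma continuous_of_norm_sub_sq_le {E F : Type*} [NormedAddCommGroup E] [NormedAddCommGroup F]
    {f : E → F} {M : ℝ} (h : ∀ y y', ‖f y - f y'‖ ^ 2 ≤ M * ‖y - y'‖ ^ 2) : Continuous f := by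
  refine continuous_iff_continuousAt.2 fun y => ?_
  rw [ContinuousAt, tendsto_iff_norm_sub_tendsto_zero]
  have hc : Continuous fun y' => √(M * ‖y' - y‖ ^ 2) := by fun_prop
  have h0 := hc.tendsto y
  simp only [sub_self, norm_zero, ne_eq, OfNat.ofNat_ne_zero, not_false_eq_true, zero_pow,
    mul_zero, Real.sqrt_zero] at h0
  exact squeeze_zero (fun _ => norm_nonneg _) (fun y' => Real.le_sqrt_of_sq_le (h y' y)) h0

/-! ### Integrals with values in a closed subspace. -/

section ClosedSubmodule

/-- A closed subspace of a Banach space is complete, so the integral can be taken inside V and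
carried over by the inclusion. -/
lemma integral_mem_of_isClosed {α E : Type*} [MeasurableSpace α] {ν : Measure α}
    [NormedAddCommGroup E] [NormedSpace ℝ E] [CompleteSpace E] {V : Submodule ℝ E}
    (hV : IsClosed (V : Set E)) {f : α → E} (hf : Integrable f ν) (hfV : ∀ y, f y ∈ V) :
    ∫ y, f y ∂ν ∈ V := by
  have : CompleteSpace V := hV.completeSpace_coe
  let g : α → V := fun y => ⟨f y, hfV y⟩
  have hg : Integrable g ν := by
    refine ⟨?_, ?_⟩
    · exact (Topology.IsEmbedding.subtypeVal.aestronglyMeasurable_comp_iff (f := g)).1 hf.1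
    · exact hf.2
  have := V.subtypeL.integral_comp_comm hg
  have e : ∫ y, f y ∂ν = V.subtypeL (∫ y, g y ∂ν) := this
  rw [e]
  exact (∫ y, g y ∂ν).2

end ClosedSubmodule

/-! ### The integral of e^{-‖w‖} and its dilations. -/

section ExpNorm

variable {d : ℕ}

lemma integrable_exp_neg_norm (hd : 1 ≤ d) :
    Integrable (fun w : EuclideanSpace ℝ (Fin d) => Real.exp (-‖w‖)) := by
  have : Nonempty (Fin d) := ⟨⟨0, hd⟩⟩
  rw [integrable_fun_norm_addHaar volume (f := fun r : ℝ => Real.exp (-r))]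
  refine (Real.GammaIntegral_convergent (s := d) (by exact_mod_cast hd)).congr_fun ?_
    measurableSet_Ioi
  intro x _
  simp only [finrank_euclideanSpace, Fintype.card_fin, smul_eq_mul]
  rw [mul_comm, ← Real.rpow_natCast]
  congr 2
  push_cast [Nat.cast_sub hd]
  rfl

/-- The integral of `e^{-‖w‖}` over `ℝᵈ`. -/
def expNormIntegral (d : ℕ) : ℝ := ∫ w : EuclideanSpace ℝ (Fin d), Real.exp (-‖w‖)

lemma expNormIntegral_nonneg : 0 ≤ expNormIntegral d :=
  integral_nonneg fun _ => (Real.exp_pos _).le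

/-- The volume of the unit ball is computed twice, as M/Γ(d+1) and as π^{d/2}/Γ(d/2+1); reducing
both Gamma values by one leaves the factor d/(d/2) = 2. -/
lemma expNormIntegral_eq (hd : 1 ≤ d) :
    expNormIntegral d
      = 2 * (Real.pi ^ ((d : ℝ) / 2) * Real.Gamma d / Real.Gamma ((d : ℝ) / 2)) := by
  have : Nonempty (Fin d) := ⟨⟨0, hd⟩⟩
  have hd0 : (0 : ℝ) < d := by exact_mod_cast hd
  have h1 := measure_unitBall_eq_integral_div_gamma
    (volume : Measure (EuclideanSpace ℝ (Fin d))) one_pos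
  have h2 := EuclideanSpace.volume_ball (Fin d) 0 1
  rw [h1] at h2
  simp only [Real.rpow_one, finrank_euclideanSpace, Fintype.card_fin, div_one, ENNReal.ofReal_one,
    one_pow, one_mul] at h2
  have hG1 : 0 < Real.Gamma ((d : ℝ) + 1) := Real.Gamma_pos_of_pos (by positivity)
  have hG2 : 0 < Real.Gamma ((d : ℝ) / 2 + 1) := Real.Gamma_pos_of_pos (by positivity)
  change ENNReal.ofReal (expNormIntegral d / _) = _ at h2
  rw [ENNReal.ofReal_eq_ofReal_iff (div_nonneg expNormIntegral_nonneg hG1.le)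
    (by positivity), div_eq_div_iff hG1.ne' hG2.ne'] at h2
  rw [Real.Gamma_add_one hd0.ne', Real.Gamma_add_one (by positivity)] at h2
  have hG3 : 0 < Real.Gamma ((d : ℝ) / 2) := Real.Gamma_pos_of_pos (by positivity)
  have hp : √Real.pi ^ d = Real.pi ^ ((d : ℝ) / 2) := by
    rw [Real.sqrt_eq_rpow, ← Real.rpow_natCast, ← Real.rpow_mul Real.pi_pos.le]
    congr 1; ring
  rw [hp] at h2
  field_simp at h2 ⊢
  linarith

lemma integrable_exp_neg_mul_norm (hd : 1 ≤ d) {a : ℝ} (ha : 0 < a) :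
    Integrable (fun w : EuclideanSpace ℝ (Fin d) => Real.exp (-(a * ‖w‖))) := by
  have := (integrable_exp_neg_norm hd).comp_smul (R := a) ha.ne'
  simpa [norm_smul, abs_of_pos ha] using this

lemma integral_exp_neg_mul_norm {a : ℝ} (ha : 0 < a) :
    ∫ w : EuclideanSpace ℝ (Fin d), Real.exp (-(a * ‖w‖)) = (a ^ d)⁻¹ * expNormIntegral d := by
  have := Measure.integral_comp_smul (volume : Measure (EuclideanSpace ℝ (Fin d)))
    (fun w => Real.exp (-‖w‖)) a
  simpa [norm_smul, abs_of_pos ha, expNormIntegral] using this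

end ExpNorm

/-! ### Continuity of the kernel in L²(μ). -/

section Kernel

variable {d : ℕ} {π : Measure (Set.Ioi (0 : ℝ))}

instance [SigmaFinite π] : SigmaFinite (controlMeasure (d := d) π) := by
  unfold controlMeasure; infer_instance

/-- Since λ^{-m} ≤ 1 + λ^{-n}, lower inverse moments of a finite measure come for free; they are
needed for m = d. -/
lemma integrable_inv_pow_of_le [IsFiniteMeasure π] {m n : ℕ} (hmn : m ≤ n)
    (hπ : Integrable (fun l : Set.Ioi (0 : ℝ) => ((l : ℝ) ^ n)⁻¹) π) :
    Integrable (fun l : Set.Ioi (0 : ℝ) => ((l : ℝ) ^ m)⁻¹) π := by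
  refine ((integrable_const (1 : ℝ)).add hπ).mono' (by fun_prop) (ae_of_all _ fun l => ?_)
  have hl : (0 : ℝ) < l := l.2
  rw [Real.norm_of_nonneg (by positivity), Pi.add_apply]
  rcases le_or_gt 1 (l : ℝ) with h | h
  · have : ((l : ℝ) ^ m)⁻¹ ≤ 1 := inv_le_one_of_one_le₀ (one_le_pow₀ h)
    have : 0 ≤ ((l : ℝ) ^ n)⁻¹ := by positivity
    linarith
  · have : ((l : ℝ) ^ m)⁻¹ ≤ ((l : ℝ) ^ n)⁻¹ := by
      gcongr 1
      exact pow_le_pow_of_le_one hl.le h.le hmn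
    linarith

lemma measurable_uncurry_kernel :
    Measurable (Function.uncurry (kernel (d := d))) := by
  unfold kernel Function.uncurry; fun_prop

lemma integral_exp_neg_mul_norm_sub {a : ℝ} (ha : 0 < a) (y : EuclideanSpace ℝ (Fin d)) :
    ∫ u : EuclideanSpace ℝ (Fin d), Real.exp (-(a * ‖y - u‖)) = (a ^ d)⁻¹ * expNormIntegral d := by
  rw [integral_sub_left_eq_self (fun w : EuclideanSpace ℝ (Fin d) => Real.exp (-(a * ‖w‖))),
    integral_exp_neg_mul_norm ha]

lemma integrable_exp_controlMeasure (hd : 1 ≤ d)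
    (hπ : Integrable (fun l : Set.Ioi (0 : ℝ) => ((l : ℝ) ^ d)⁻¹) π)
    (y : EuclideanSpace ℝ (Fin d)) :
    Integrable (fun z : ParamSpace d => Real.exp (-((z.1 : ℝ) * ‖y - z.2‖))) (controlMeasure π) := by
  unfold controlMeasure
  rw [integrable_prod_iff (by fun_prop)]
  refine ⟨ae_of_all _ fun l => ?_, ?_⟩
  · exact (integrable_exp_neg_mul_norm hd l.2).comp_sub_left y
  · simp only [Real.norm_eq_abs, Real.abs_exp]
    simp_rw [fun l : Set.Ioi (0 : ℝ) => integral_exp_neg_mul_norm_sub l.2 y]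
    exact hπ.mul_const _

variable [SFinite π]

lemma integral_exp_controlMeasure (hd : 1 ≤ d)
    (hπ : Integrable (fun l : Set.Ioi (0 : ℝ) => ((l : ℝ) ^ d)⁻¹) π)
    (y : EuclideanSpace ℝ (Fin d)) :
    ∫ z : ParamSpace d, Real.exp (-((z.1 : ℝ) * ‖y - z.2‖)) ∂(controlMeasure π)
      = (∫ l : Set.Ioi (0 : ℝ), ((l : ℝ) ^ d)⁻¹ ∂π) * expNormIntegral d := by
  have h := integrable_exp_controlMeasure hd hπ y
  unfold controlMeasure at h ⊢
  rw [integral_prod _ h, ← integral_mul_const]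
  exact integral_congr_ae (ae_of_all _ fun l => integral_exp_neg_mul_norm_sub l.2 y)

/-- For x ≤ y the difference is at most (y - x)e^{-x}, and e^{-2x} ≤ e^{-x}. The sum on the right
makes the bound symmetric. -/
lemma abs_exp_neg_sub_exp_neg_le {x y : ℝ} (hx : 0 ≤ x) (hy : 0 ≤ y) :
    (Real.exp (-x) - Real.exp (-y)) ^ 2 ≤ (x - y) ^ 2 * (Real.exp (-x) + Real.exp (-y)) := by
  wlog hxy : x ≤ y generalizing x y
  · have := this hy hx (le_of_not_ge hxy)
    linarith
  have h1 : 0 ≤ Real.exp (-x) - Real.exp (-y) :=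
    sub_nonneg.2 (Real.exp_le_exp.2 (by linarith))
  have h2 : Real.exp (-x) - Real.exp (-y) ≤ (y - x) * Real.exp (-x) := by
    have h3 : Real.exp (-y) = Real.exp (-x) * Real.exp (x - y) := by rw [← Real.exp_add]; congr 1; ring
    have h4 := Real.add_one_le_exp (x - y)
    rw [h3]
    nlinarith [Real.exp_pos (-x)]
  have h5 : Real.exp (-x) ≤ 1 := Real.exp_le_one_iff.2 (by linarith)
  have h6 := Real.exp_pos (-x)
  have h7 := Real.exp_pos (-y)
  calc (Real.exp (-x) - Real.exp (-y)) ^ 2 ≤ ((y - x) * Real.exp (-x)) ^ 2 :=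
        pow_le_pow_left₀ h1 h2 2
    _ = (x - y) ^ 2 * (Real.exp (-x) * Real.exp (-x)) := by ring
    _ ≤ (x - y) ^ 2 * (Real.exp (-x) + Real.exp (-y)) := by
        gcongr
        nlinarith

/-- The Lipschitz constant λ of the exponent cancels the prefactor 1/λ of the kernel. After
integration in u only the moment of order d remains. -/
lemma kernel_sub_sq_le (y y' : EuclideanSpace ℝ (Fin d)) (z : ParamSpace d) :
    (kernel y z - kernel y' z) ^ 2 ≤ ‖y - y'‖ ^ 2 / 4 *
      (Real.exp (-((z.1 : ℝ) * ‖y - z.2‖)) + Real.exp (-((z.1 : ℝ) * ‖y' - z.2‖))) := by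
  obtain ⟨⟨l, hl⟩, u⟩ := z
  have hl' : 0 < l := hl
  simp only [kernel]
  have h1 := abs_exp_neg_sub_exp_neg_le (x := l * ‖y - u‖) (y := l * ‖y' - u‖)
    (by positivity) (by positivity)
  have h2 : (l * ‖y - u‖ - l * ‖y' - u‖) ^ 2 ≤ l ^ 2 * ‖y - y'‖ ^ 2 := by
    rw [← mul_sub, mul_pow]
    have h := abs_norm_sub_norm_le (y - u) (y' - u)
    rw [sub_sub_sub_cancel_right, abs_le] at h
    exact mul_le_mul_of_nonneg_left (sq_le_sq' h.1 h.2) (sq_nonneg l)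
  have h3 : 0 ≤ Real.exp (-(l * ‖y - u‖)) + Real.exp (-(l * ‖y' - u‖)) := by positivity
  have h4 := h1.trans (mul_le_mul_of_nonneg_right h2 h3)
  calc _ = (1 / (4 * l ^ 2)) * (Real.exp (-(l * ‖y - u‖)) - Real.exp (-(l * ‖y' - u‖))) ^ 2 := by
        simp only [neg_mul]
        field_simp
        ring
    _ ≤ (1 / (4 * l ^ 2)) * (l ^ 2 * ‖y - y'‖ ^ 2 *
          (Real.exp (-(l * ‖y - u‖)) + Real.exp (-(l * ‖y' - u‖)))) := by gcongr
    _ = _ := by field_simp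

lemma integral_kernel_sub_sq_le (hd : 1 ≤ d)
    (hπ : Integrable (fun l : Set.Ioi (0 : ℝ) => ((l : ℝ) ^ d)⁻¹) π)
    (y y' : EuclideanSpace ℝ (Fin d)) :
    ∫ z, (kernel y z - kernel y' z) ^ 2 ∂(controlMeasure π)
      ≤ (∫ l : Set.Ioi (0 : ℝ), ((l : ℝ) ^ d)⁻¹ ∂π) * expNormIntegral d / 2 * ‖y - y'‖ ^ 2 := by
  have hi := integrable_exp_controlMeasure (π := π) hd hπ
  have h := integral_mono_of_nonneg (ae_of_all (controlMeasure π) fun z => sq_nonneg _)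
    (((hi y).add (hi y')).const_mul (‖y - y'‖ ^ 2 / 4))
    (ae_of_all _ fun z => kernel_sub_sq_le y y' z)
  refine h.trans (le_of_eq ?_)
  simp only [Pi.add_apply]
  rw [integral_const_mul, integral_add (hi y) (hi y'), integral_exp_controlMeasure hd hπ,
    integral_exp_controlMeasure hd hπ]
  ring

end Kernel

/-! ### Stochastic Fubini and the law of the integrated field. -/

section IntegratedField

variable {Ω : Type*} [MeasurableSpace Ω] {P : Measure Ω} [IsProbabilityMeasure P] {d : ℕ}
  {b : ℝ} {W : Measure ℝ} {π : Measure (Set.Ioi (0 : ℝ))} [IsProbabilityMeasure π]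
  {X : EuclideanSpace ℝ (Fin d) → Ω → ℝ} {S : Set (Set (ParamSpace d))}
  {Λ : Set (ParamSpace d) → Ω → ℝ}

/-- The stochastic Fubini theorem for the supCAR field: the integral of the field over a bounded
set is the stochastic integral of the integrated kernel. -/
lemma exists_mem_integralGraph_setIntegral (hd : 1 ≤ d) (hb : 0 < b)
    (hW2 : Integrable (fun x : ℝ => x ^ 2) W)
    (hπ : Integrable (fun l : Set.Ioi (0 : ℝ) => ((l : ℝ) ^ d)⁻¹) π)
    (hS : IsExhaustingDeltaRing S (controlMeasure π))
    (hΛ : IsScatteredRandomMeasure P S (controlMeasure π) (cumulantFn 0 b W) Λ)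
    (hX : ∀ t, IsRandomIntegral P S (controlMeasure π) Λ (kernel t) (X t))
    (hXmeas : AEMeasurable (Function.uncurry X) (volume.prod P))
    {D : Set (EuclideanSpace ℝ (Fin d))} (hD : Bornology.IsBounded D) :
    (∀ᵐ ω ∂P, IntegrableOn (fun y => X y ω) D) ∧
    ∃ q ∈ integralGraph P S (controlMeasure π) Λ,
      q.1 =ᵐ[controlMeasure π] (fun z => ∫ y in D, kernel y z) ∧
      q.2 =ᵐ[P] fun ω => ∫ y in D, X y ω := by
  choose p hp h1 h2 using fun t => (hX t).exists_mem_integralGraph hb hW2 hS hΛ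
  set C : ℝ := (∫ l : Set.Ioi (0 : ℝ), ((l : ℝ) ^ d)⁻¹ ∂π) * expNormIntegral d / 2 with hC
  have hσ := levyVariance_pos (W := W) hb
  have hl1 : ∀ y y', ‖(p y).1 - (p y').1‖ ^ 2 ≤ C * ‖y - y'‖ ^ 2 := fun y y' => by
    refine le_trans (le_of_eq ?_) (integral_kernel_sub_sq_le hd hπ y y')
    rw [norm_sq_Lp]
    refine integral_congr_ae ?_
    filter_upwards [Lp.coeFn_sub (p y).1 (p y').1, h1 y, h1 y'] with z h3 h4 h5
    rw [h3, Pi.sub_apply, h4, h5]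
  have hl2 : ∀ y y', ‖(p y).2 - (p y').2‖ ^ 2
      ≤ 4 * levyVariance b W * C * ‖y - y'‖ ^ 2 := fun y y' => by
    have := norm_snd_sq_le_of_mem_integralGraph hb.le hW2 hS hΛ
      (Submodule.sub_mem _ (hp y) (hp y'))
    rw [Prod.fst_sub, Prod.snd_sub] at this
    have h3 := mul_le_mul_of_nonneg_left (hl1 y y') (by positivity : 0 ≤ 4 * levyVariance b W)
    linarith
  have hc1 : Continuous fun y => (p y).1 := continuous_of_norm_sub_sq_le hl1
  have hc2 : Continuous fun y => (p y).2 := continuous_of_norm_sub_sq_le hl2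
  have hcp : Continuous p := hc1.prodMk hc2
  obtain ⟨R, hR⟩ := hD.subset_closedBall 0
  have hpi : Integrable p (volume.restrict D) :=
    (hcp.continuousOn.integrableOn_compact (isCompact_closedBall 0 R)).mono_set hR
  have hXm : AEStronglyMeasurable (Function.uncurry X) ((volume.restrict D).prod P) :=
    (hXmeas.mono_ac (Measure.restrict_le_self.absolutelyContinuous.prod
      Measure.AbsolutelyContinuous.rfl)).aestronglyMeasurable
  have hp1 : Integrable (fun y => (p y).1) (volume.restrict D) := hpi.fst
  have hp2 : Integrable (fun y => (p y).2) (volume.restrict D) := hpi.snd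
  -- Integrating the pair (kernel, field) in the product space keeps it in the closed graph; each
  -- coordinate is then identified with the corresponding pointwise integral.
  refine ⟨ae_integrable_of_Lp hXm hp2 (ae_of_all _ h2), ∫ y in D, p y, ?_, ?_, ?_⟩
  · exact integral_mem_of_isClosed (Submodule.isClosed_topologicalClosure _) hpi hp
  · rw [fst_integral hpi]
    exact coeFn_integral_Lp measurable_uncurry_kernel.aestronglyMeasurable hp1 (ae_of_all _ h1)
  · rw [snd_integral hpi]
    exact coeFn_integral_Lp hXm hp2 (ae_of_all _ h2)

/-- The joint characteristic function of integrals of the supCAR field over bounded sets. -/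
lemma charFun_sum_setIntegral (hd : 1 ≤ d) (hb : 0 < b)
    (hW2 : Integrable (fun x : ℝ => x ^ 2) W)
    (hπ : Integrable (fun l : Set.Ioi (0 : ℝ) => ((l : ℝ) ^ d)⁻¹) π)
    (hX : IsSupCARField P 0 b W π X)
    (hXmeas : AEMeasurable (Function.uncurry X) (volume.prod P))
    {ι : Type*} [Fintype ι] {D : ι → Set (EuclideanSpace ℝ (Fin d))}
    (hD : ∀ i, Bornology.IsBounded (D i)) (θ : ι → ℝ) :
    Integrable (fun z => cumulantFn 0 b W (∑ i, θ i * ∫ y in D i, kernel y z))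
      (controlMeasure π) ∧
    ∫ ω, Complex.exp (Complex.I * ((∑ i, θ i * ∫ y in D i, X y ω : ℝ) : ℂ)) ∂P
      = Complex.exp (∫ z, cumulantFn 0 b W (∑ i, θ i * ∫ y in D i, kernel y z)
          ∂(controlMeasure π)) := by
  obtain ⟨S, Λ, hS, hΛ, hX⟩ := hX
  choose q hq h1 h2 using fun i =>
    (exists_mem_integralGraph_setIntegral hd hb hW2 hπ hS hΛ hX hXmeas (hD i)).2
  have h := charFun_of_mem_integralGraph hb.le hW2 hS hΛ
    (Submodule.sum_mem _ fun i (_ : i ∈ Finset.univ) => Submodule.smul_mem _ (θ i) (hq i))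
  have e1 : (∑ i, θ i • q i).1
      =ᵐ[controlMeasure π] fun z => ∑ i, θ i * ∫ y in D i, kernel y z := by
    rw [Prod.fst_sum]
    refine (Lp.coeFn_finsetSum _ _).trans ?_
    filter_upwards [ae_all_iff.2 fun i => Lp.coeFn_smul (θ i) (q i).1, ae_all_iff.2 h1] with z h3 h4
    rw [Finset.sum_apply]
    exact Finset.sum_congr rfl fun i _ => by
      rw [Prod.smul_fst, h3, Pi.smul_apply, h4, smul_eq_mul]
  have e2 : (∑ i, θ i • q i).2 =ᵐ[P] fun ω => ∑ i, θ i * ∫ y in D i, X y ω := by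
    rw [Prod.snd_sum]
    refine (Lp.coeFn_finsetSum _ _).trans ?_
    filter_upwards [ae_all_iff.2 fun i => Lp.coeFn_smul (θ i) (q i).2, ae_all_iff.2 h2] with z h3 h4
    rw [Finset.sum_apply]
    exact Finset.sum_congr rfl fun i _ => by
      rw [Prod.smul_snd, h3, Pi.smul_apply, h4, smul_eq_mul]
  refine ⟨(integrable_cumulantFn_comp hb.le hW2 (Lp.aestronglyMeasurable (∑ i, θ i • q i).1)
    (integrable_sq_Lp _)).congr (by filter_upwards [e1] with z h; rw [h]), ?_⟩
  rw [integral_congr_ae (g := fun ω => Complex.exp (Complex.I * ((∑ i, θ i • q i).2 ω : ℂ)))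
    (by filter_upwards [e2] with ω h; rw [h]), h]
  congr 1
  exact integral_congr_ae (by filter_upwards [e1] with z h; rw [h])

end IntegratedField

/-! ### Indicators smoothed by an exponential kernel. -/

section SmoothedIndicator

variable {d : ℕ}

/-- The convolution of the indicator function of `A` with the (unnormalised) approximate identity
`w ↦ aᵈ e^{-a ‖w‖}`. -/
def smoothedIndicator (A : Set (EuclideanSpace ℝ (Fin d))) (a : ℝ)
    (v : EuclideanSpace ℝ (Fin d)) : ℝ :=
  ∫ w, A.indicator (fun _ => (1 : ℝ)) (v + a⁻¹ • w) * Real.exp (-‖w‖)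

variable {A : Set (EuclideanSpace ℝ (Fin d))}

/-- Substitution y = T • v + λ⁻¹ • w: then y ∈ T • A exactly when v + (λT)⁻¹ • w ∈ A, so λ and T
enter the smoothing only through λT. -/
lemma setIntegral_exp_eq_smoothedIndicator (hA : MeasurableSet A) {l T : ℝ} (hl : 0 < l)
    (hT : 0 < T) (v : EuclideanSpace ℝ (Fin d)) :
    ∫ y in T • A, Real.exp (-l * ‖y - T • v‖) = (l ^ d)⁻¹ * smoothedIndicator A (l * T) v := by
  rw [← integral_indicator (hA.const_smul_of_ne_zero hT.ne')]
  rw [← integral_add_left_eq_self _ (T • v)]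
  have h := Measure.integral_comp_smul (volume : Measure (EuclideanSpace ℝ (Fin d)))
    (fun y => (T • A).indicator (fun y => Real.exp (-l * ‖y - T • v‖)) (T • v + y)) l⁻¹
  rw [finrank_euclideanSpace, Fintype.card_fin, abs_of_pos (by positivity), smul_eq_mul, inv_pow,
    inv_inv] at h
  have hl' : (l ^ d) ≠ 0 := by positivity
  rw [eq_inv_mul_iff_mul_eq₀ hl', ← h, smoothedIndicator]
  congr 1
  ext w
  have e1 : T • v + l⁻¹ • w = T • (v + (l * T)⁻¹ • w) := by
    rw [smul_add, smul_smul, mul_inv, ← mul_assoc, mul_comm T, mul_assoc,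
      mul_inv_cancel₀ hT.ne', mul_one]
  have e2 : -l * ‖T • v + l⁻¹ • w - T • v‖ = -‖w‖ := by
    rw [add_sub_cancel_left, norm_smul, Real.norm_of_nonneg (by positivity)]
    field_simp
  by_cases hw : v + (l * T)⁻¹ • w ∈ A
  · rw [Set.indicator_of_mem hw, Set.indicator_of_mem, e2, one_mul]
    rw [e1]
    exact Set.smul_mem_smul_set hw
  · rw [Set.indicator_of_notMem hw, Set.indicator_of_notMem, zero_mul]
    rw [e1, Set.smul_mem_smul_set_iff₀ hT.ne']
    exact hw

lemma setIntegral_kernel_eq (hA : MeasurableSet A) (l : Set.Ioi (0 : ℝ)) {T : ℝ}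
    (hT : 0 < T) (v : EuclideanSpace ℝ (Fin d)) :
    ∫ y in T • A, kernel y (l, T • v)
      = -(1 / 2 * ((l : ℝ) ^ (d + 1))⁻¹) * smoothedIndicator A (l * T) v := by
  simp only [kernel]
  rw [integral_neg, integral_const_mul, setIntegral_exp_eq_smoothedIndicator hA l.2 hT]
  have : (l : ℝ) ≠ 0 := (show (0 : ℝ) < l from l.2).ne'
  field_simp
  ring

lemma indicator_mul_exp_le (a : ℝ) (v w : EuclideanSpace ℝ (Fin d)) :
    ‖A.indicator (fun _ => (1 : ℝ)) (v + a⁻¹ • w) * Real.exp (-‖w‖)‖ ≤ Real.exp (-‖w‖) := by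
  rw [norm_mul, Real.norm_of_nonneg (Real.exp_pos _).le]
  refine mul_le_of_le_one_left (Real.exp_pos _).le ?_
  by_cases h : v + a⁻¹ • w ∈ A <;> simp [h]

lemma measurable_indicator_mul_exp (hA : MeasurableSet A) (a : ℝ) :
    Measurable (fun p : EuclideanSpace ℝ (Fin d) × EuclideanSpace ℝ (Fin d) =>
      A.indicator (fun _ => (1 : ℝ)) (p.1 + a⁻¹ • p.2) * Real.exp (-‖p.2‖)) := by
  have h : Measurable (A.indicator (fun _ => (1 : ℝ))) := measurable_const.indicator hA
  have h2 : Measurable (fun p : EuclideanSpace ℝ (Fin d) × EuclideanSpace ℝ (Fin d) =>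
    p.1 + a⁻¹ • p.2) := by fun_prop
  exact (h.comp h2).mul (by fun_prop)

lemma smoothedIndicator_nonneg (a : ℝ) (v : EuclideanSpace ℝ (Fin d)) :
    0 ≤ smoothedIndicator A a v :=
  integral_nonneg fun _ =>
    mul_nonneg (Set.indicator_nonneg (fun _ _ => zero_le_one) _) (Real.exp_pos _).le

lemma smoothedIndicator_le (hd : 1 ≤ d) (a : ℝ) (v : EuclideanSpace ℝ (Fin d)) :
    smoothedIndicator A a v ≤ expNormIntegral d :=
  integral_mono_of_nonneg
    (ae_of_all _ fun _ =>
      mul_nonneg (Set.indicator_nonneg (fun _ _ => zero_le_one) _) (Real.exp_pos _).le)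
    (integrable_exp_neg_norm hd)
    (ae_of_all _ fun w => (le_abs_self _).trans (indicator_mul_exp_le a v w))

lemma measurable_smoothedIndicator (hA : MeasurableSet A) (a : ℝ) :
    Measurable (smoothedIndicator A a) :=
  (measurable_indicator_mul_exp hA a).stronglyMeasurable.integral_prod_right'.measurable

lemma integrable_indicator_mul_exp (hd : 1 ≤ d) (hA : MeasurableSet A) (hAfin : volume A ≠ ⊤)
    (a : ℝ) :
    Integrable (fun p : EuclideanSpace ℝ (Fin d) × EuclideanSpace ℝ (Fin d) =>
      A.indicator (fun _ => (1 : ℝ)) (p.1 + a⁻¹ • p.2) * Real.exp (-‖p.2‖))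
      (volume.prod volume) := by
  have hi : Integrable (A.indicator (fun _ => (1 : ℝ))) :=
    (integrable_indicator_iff hA).2 (integrableOn_const hAfin)
  rw [integrable_prod_iff' (measurable_indicator_mul_exp hA a).aestronglyMeasurable]
  refine ⟨ae_of_all _ fun w => (hi.comp_add_right (a⁻¹ • w)).mul_const (Real.exp (-‖w‖)), ?_⟩
  simp only [norm_mul, integral_mul_const]
  have : ∀ w : EuclideanSpace ℝ (Fin d), ∫ v, ‖A.indicator (fun _ => (1 : ℝ)) (v + a⁻¹ • w)‖
      = ∫ v, ‖A.indicator (fun _ => (1 : ℝ)) v‖ := fun w =>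
    integral_add_right_eq_self (fun v => ‖A.indicator (fun _ => (1 : ℝ)) v‖) _
  simp_rw [this, Real.norm_eq_abs, Real.abs_exp]
  exact (integrable_exp_neg_norm hd).const_mul _

lemma integrable_smoothedIndicator (hd : 1 ≤ d) (hA : MeasurableSet A) (hAfin : volume A ≠ ⊤)
    (a : ℝ) : Integrable (smoothedIndicator A a) :=
  (integrable_indicator_mul_exp hd hA hAfin a).integral_prod_left

/-- Fubini and translation invariance. Independence of a is the point: it yields bounds uniform in λ
and T. -/
lemma integral_smoothedIndicator (hd : 1 ≤ d) (hA : MeasurableSet A) (hAfin : volume A ≠ ⊤)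
    (a : ℝ) : ∫ v, smoothedIndicator A a v = volume.real A * expNormIntegral d := by
  unfold smoothedIndicator
  rw [integral_integral_swap (integrable_indicator_mul_exp hd hA hAfin a)]
  simp only [integral_mul_const]
  have : ∀ w : EuclideanSpace ℝ (Fin d), ∫ v, A.indicator (fun _ => (1 : ℝ)) (v + a⁻¹ • w)
      = volume.real A := fun w => by
    rw [integral_add_right_eq_self (fun v => A.indicator (fun _ => (1 : ℝ)) v),
      integral_indicator_const _ hA, smul_eq_mul, mul_one]
  simp_rw [this]
  rw [integral_const_mul, expNormIntegral]

/-- Away from the frontier the indicator is locally constant, so the integrand is eventually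
constant in a for each w. -/
lemma tendsto_smoothedIndicator (hd : 1 ≤ d) (hA : MeasurableSet A)
    {v : EuclideanSpace ℝ (Fin d)} (hv : v ∉ frontier A) :
    Tendsto (fun a => smoothedIndicator A a v) atTop
      (𝓝 (A.indicator (fun _ => (1 : ℝ)) v * expNormIntegral d)) := by
  unfold smoothedIndicator expNormIntegral
  rw [← integral_const_mul]
  refine tendsto_integral_filter_of_dominated_convergence (fun w => Real.exp (-‖w‖))
    (Eventually.of_forall fun a => ?_) (Eventually.of_forall fun a => ae_of_all _ fun w =>
      indicator_mul_exp_le a v w) (integrable_exp_neg_norm hd) (ae_of_all _ fun w => ?_)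
  · exact ((measurable_indicator_mul_exp hA a).comp measurable_prodMk_left).aestronglyMeasurable
  · have h0 : Tendsto (fun a : ℝ => v + a⁻¹ • w) atTop (𝓝 v) := by
      simpa using ((tendsto_inv_atTop_zero (𝕜 := ℝ)).smul_const w).const_add v
    have hev : ∀ᶠ x in 𝓝 v,
        A.indicator (fun _ => (1 : ℝ)) x = A.indicator (fun _ => (1 : ℝ)) v := by
      by_cases hi : v ∈ interior A
      · filter_upwards [mem_interior_iff_mem_nhds.1 hi] with x hx
        rw [Set.indicator_of_mem hx, Set.indicator_of_mem (interior_subset hi)]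
      · have hc : v ∉ closure A := fun h => hv ⟨h, hi⟩
        filter_upwards [isClosed_closure.isOpen_compl.mem_nhds hc] with x hx
        rw [Set.indicator_of_notMem fun h => hx (subset_closure h),
          Set.indicator_of_notMem fun h => hc (subset_closure h)]
    refine tendsto_const_nhds.congr' ?_
    filter_upwards [h0.eventually hev] with a ha
    rw [ha]

/-- If v + a⁻¹ • w lies in A then a₀‖v‖ ≤ a₀R + ‖w‖. Half of the decay in w is traded for decay in
v, and the other half keeps the integral finite. The bound is uniform in a ≥ a₀. -/
lemma smoothedIndicator_le_exp (hd : 1 ≤ d) {R : ℝ}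
    (hAR : A ⊆ Metric.closedBall 0 R) {a₀ a : ℝ} (ha₀ : 0 < a₀) (ha : a₀ ≤ a)
    (v : EuclideanSpace ℝ (Fin d)) :
    smoothedIndicator A a v ≤ Real.exp (a₀ * R / 2) * Real.exp (-(a₀ / 2 * ‖v‖))
      * ((2⁻¹ ^ d)⁻¹ * expNormIntegral d) := by
  rw [← integral_exp_neg_mul_norm (by norm_num : (0 : ℝ) < 2⁻¹), ← integral_const_mul]
  refine integral_mono_of_nonneg (ae_of_all _ fun _ =>
      mul_nonneg (Set.indicator_nonneg (fun _ _ => zero_le_one) _) (Real.exp_pos _).le)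
    ((integrable_exp_neg_mul_norm hd (by norm_num)).const_mul _) (ae_of_all _ fun w => ?_)
  by_cases hw : v + a⁻¹ • w ∈ A
  · simp only [Set.indicator_of_mem hw, one_mul]
    rw [← Real.exp_add, ← Real.exp_add]
    refine Real.exp_le_exp.2 ?_
    have h1 : ‖v + a⁻¹ • w‖ ≤ R := by simpa using hAR hw
    have ha' : 0 < a := ha₀.trans_le ha
    have h2 : ‖v‖ ≤ R + a⁻¹ * ‖w‖ := by
      calc ‖v‖ = ‖(v + a⁻¹ • w) - a⁻¹ • w‖ := by rw [add_sub_cancel_right]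
        _ ≤ ‖v + a⁻¹ • w‖ + ‖a⁻¹ • w‖ := norm_sub_le _ _
        _ ≤ R + a⁻¹ * ‖w‖ := by
          rw [norm_smul, Real.norm_of_nonneg (by positivity)]
          gcongr
    have h3 : a₀ * (a⁻¹ * ‖w‖) ≤ ‖w‖ := by
      rw [← mul_assoc, ← div_eq_mul_inv]
      exact mul_le_of_le_one_left (norm_nonneg _) ((div_le_one ha').2 ha)
    nlinarith [mul_le_mul_of_nonneg_left h2 ha₀.le]
  · simp only [Set.indicator_of_notMem hw, zero_mul]
    positivity

variable {ι : Type*} [Fintype ι] {A : ι → Set (EuclideanSpace ℝ (Fin d))}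

lemma abs_sum_smoothedIndicator_le (θ : ι → ℝ) (a : ℝ) (v : EuclideanSpace ℝ (Fin d)) :
    |∑ i, θ i * smoothedIndicator (A i) a v| ≤ ∑ i, |θ i| * smoothedIndicator (A i) a v := by
  refine (Finset.abs_sum_le_sum_abs _ _).trans (Finset.sum_le_sum fun i _ => ?_)
  rw [abs_mul, abs_of_nonneg (smoothedIndicator_nonneg a v)]

/-- One factor is estimated by its supremum and the other kept, which turns the L¹ bound that is
uniform in a into an L² bound. -/
lemma sum_smoothedIndicator_sq_le (hd : 1 ≤ d) (θ : ι → ℝ) (a : ℝ)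
    (v : EuclideanSpace ℝ (Fin d)) :
    (∑ i, θ i * smoothedIndicator (A i) a v) ^ 2
      ≤ ((∑ i, |θ i|) * expNormIntegral d) * ∑ i, |θ i| * smoothedIndicator (A i) a v := by
  have h1 := abs_sum_smoothedIndicator_le (A := A) θ a v
  have h2 : ∑ i, |θ i| * smoothedIndicator (A i) a v ≤ (∑ i, |θ i|) * expNormIntegral d := by
    rw [Finset.sum_mul]
    exact Finset.sum_le_sum fun i _ =>
      mul_le_mul_of_nonneg_left (smoothedIndicator_le hd a v) (abs_nonneg _)
  rw [← sq_abs, sq]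
  exact mul_le_mul (h1.trans h2) h1 (abs_nonneg _) ((abs_nonneg _).trans (h1.trans h2))

lemma integrable_sum_smoothedIndicator_sq (hd : 1 ≤ d) (hA : ∀ i, MeasurableSet (A i))
    (hAfin : ∀ i, volume (A i) ≠ ⊤) (θ : ι → ℝ) (a : ℝ) :
    Integrable (fun v => (∑ i, θ i * smoothedIndicator (A i) a v) ^ 2) := by
  have hm := fun i => measurable_smoothedIndicator (hA i) a
  refine (Integrable.const_mul (integrable_finsetSum Finset.univ fun i _ =>
    (integrable_smoothedIndicator hd (hA i) (hAfin i) a).const_mul |θ i|)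
    ((∑ i, |θ i|) * expNormIntegral d)).mono' (by fun_prop) (ae_of_all _ fun v => ?_)
  rw [Real.norm_of_nonneg (sq_nonneg _)]
  exact sum_smoothedIndicator_sq_le hd θ a v

lemma integral_sum_smoothedIndicator_sq_le (hd : 1 ≤ d) (hA : ∀ i, MeasurableSet (A i))
    (hAfin : ∀ i, volume (A i) ≠ ⊤) (θ : ι → ℝ) (a : ℝ) :
    ∫ v, (∑ i, θ i * smoothedIndicator (A i) a v) ^ 2
      ≤ ((∑ i, |θ i|) * expNormIntegral d)
        * ∑ i, |θ i| * (volume.real (A i) * expNormIntegral d) := by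
  have hi := fun i => (integrable_smoothedIndicator hd (hA i) (hAfin i) a).const_mul |θ i|
  refine (integral_mono (integrable_sum_smoothedIndicator_sq hd hA hAfin θ a)
    (Integrable.const_mul (integrable_finsetSum Finset.univ fun i _ => hi i) _)
    (sum_smoothedIndicator_sq_le hd θ a)).trans (le_of_eq ?_)
  rw [integral_const_mul, integral_finsetSum _ fun i _ => hi i]
  simp only [integral_const_mul]
  congr 1
  exact Finset.sum_congr rfl fun i _ => by rw [integral_smoothedIndicator hd (hA i) (hAfin i)]

end SmoothedIndicator

/-! ### The limit of the exponent. -/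

section Limit

variable {d : ℕ} {b : ℝ} {W : Measure ℝ} {ι : Type*} [Fintype ι]
  {A : ι → Set (EuclideanSpace ℝ (Fin d))}

lemma norm_sq_mul_cumulantFn_le (hb : 0 ≤ b) (hW2 : Integrable (fun x : ℝ => x ^ 2) W) {n : ℝ}
    (hn : 0 < n) (x : ℝ) :
    ‖((n ^ 2 : ℝ) : ℂ) * cumulantFn 0 b W (n⁻¹ * x)‖ ≤ levyVariance b W * x ^ 2 := by
  rw [norm_mul, Complex.norm_real, Real.norm_of_nonneg (by positivity)]
  calc _ ≤ n ^ 2 * (levyVariance b W * (n⁻¹ * x) ^ 2) := by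
        gcongr; exact norm_cumulantFn_le hb hW2 _
    _ = levyVariance b W * x ^ 2 := by field_simp

/-- The central limit mechanism: scaling annihilates everything beyond the second order Taylor term
of 𝒦. -/
lemma tendsto_sq_mul_cumulantFn (hW2 : Integrable (fun x : ℝ => x ^ 2) W) {α : Type*}
    {F : Filter α} {n x : α → ℝ} {y : ℝ} (hn : Tendsto n F atTop) (hx : Tendsto x F (𝓝 y)) :
    Tendsto (fun T => ((n T ^ 2 : ℝ) : ℂ) * cumulantFn 0 b W ((n T)⁻¹ * x T)) F
      (𝓝 ((-(levyVariance b W / 2) * y ^ 2 : ℝ) : ℂ)) := by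
  have h1 : Tendsto (fun T => ((n T ^ 2 : ℝ) : ℂ) * cumulantFn 0 b W ((n T)⁻¹ * x T)
      + ((levyVariance b W / 2 * x T ^ 2 : ℝ) : ℂ)) F (𝓝 0) := by
    rw [tendsto_zero_iff_norm_tendsto_zero, Metric.tendsto_nhds]
    intro ε hε
    -- After multiplication by n² the Taylor error is at most this constant times x², and eventually
    -- x² < y² + 1, which leaves ε/2.
    obtain ⟨δ, hδ, hK⟩ := cumulantFn_taylor (b := b) hW2
      (ε := ε / (2 * (y ^ 2 + 1))) (by positivity)
    have h0 : Tendsto (fun T => (n T)⁻¹ * x T) F (𝓝 0) := by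
      simpa using hn.inv_tendsto_atTop.mul hx
    have h2 : ∀ᶠ T in F, |(n T)⁻¹ * x T| < δ := by
      have := Metric.tendsto_nhds.1 h0 δ hδ
      simpa using this
    have h3 : ∀ᶠ T in F, x T ^ 2 < y ^ 2 + 1 :=
      (hx.pow 2).eventually_lt_const (by linarith)
    filter_upwards [h2, h3, hn.eventually_gt_atTop 0] with T hT2 hT3 hT0
    rw [dist_zero_right, norm_norm]
    have e : ((n T ^ 2 : ℝ) : ℂ) * cumulantFn 0 b W ((n T)⁻¹ * x T)
        + ((levyVariance b W / 2 * x T ^ 2 : ℝ) : ℂ)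
        = ((n T ^ 2 : ℝ) : ℂ) * (cumulantFn 0 b W ((n T)⁻¹ * x T)
          + ((levyVariance b W / 2 : ℝ) : ℂ) * (((n T)⁻¹ * x T : ℝ) : ℂ) ^ 2) := by
      have : (n T : ℂ) ≠ 0 := by exact_mod_cast hT0.ne'
      push_cast
      field_simp
    rw [e, norm_mul, Complex.norm_real, Real.norm_of_nonneg (by positivity)]
    calc _ ≤ n T ^ 2 * (ε / (2 * (y ^ 2 + 1)) * ((n T)⁻¹ * x T) ^ 2) := by
          gcongr; exact hK _ hT2.le
      _ = ε / (2 * (y ^ 2 + 1)) * x T ^ 2 := by field_simp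
      _ ≤ ε / (2 * (y ^ 2 + 1)) * (y ^ 2 + 1) := by gcongr
      _ = ε / 2 := by field_simp
      _ < ε := half_lt_self hε
  have h4 : Tendsto (fun T => ((levyVariance b W / 2 * x T ^ 2 : ℝ) : ℂ)) F
      (𝓝 ((levyVariance b W / 2 * y ^ 2 : ℝ) : ℂ)) :=
    (Complex.continuous_ofReal.tendsto _).comp ((hx.pow 2).const_mul _)
  have h5 := h1.sub h4
  simp only [add_sub_cancel_right, zero_sub] at h5
  convert! h5 using 2
  push_cast; ring

/-- The limit of the cumulant of the integrated field for a fixed value `l` of the parameter. -/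
lemma tendsto_integral_smoothedIndicator (hd : 1 ≤ d) (hb : 0 ≤ b)
    (hW2 : Integrable (fun x : ℝ => x ^ 2) W) (hA : ∀ i, MeasurableSet (A i))
    (hAbdd : ∀ i, Bornology.IsBounded (A i)) (hAf : ∀ i, volume (frontier (A i)) = 0)
    (θ : ι → ℝ) (β : ℝ) {l : ℝ} (hl : 0 < l) {n : ℝ → ℝ} (hn : Tendsto n atTop atTop) :
    Tendsto (fun T => ∫ v, ((n T ^ 2 : ℝ) : ℂ) *
        cumulantFn 0 b W ((n T)⁻¹ * (β * ∑ i, θ i * smoothedIndicator (A i) (l * T) v))) atTop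
      (𝓝 ((-(levyVariance b W / 2) * (β * expNormIntegral d) ^ 2 *
        ∫ v, (∑ i, θ i * (A i).indicator (fun _ => (1 : ℝ)) v) ^ 2 : ℝ) : ℂ)) := by
  have hR : ∃ R, ∀ i, A i ⊆ Metric.closedBall 0 R := by
    have : Bornology.IsBounded (⋃ i, A i) := Bornology.isBounded_iUnion.2 hAbdd
    obtain ⟨R, hR⟩ := this.subset_closedBall 0
    exact ⟨R, fun i => (Set.subset_iUnion A i).trans hR⟩
  obtain ⟨R, hR⟩ := hR
  set C : ℝ := (∑ i, |θ i|) * (Real.exp (l * R / 2) * ((2⁻¹ ^ d)⁻¹ * expNormIntegral d)) with hC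
  rw [← integral_const_mul, ← integral_complex_ofReal]
  refine tendsto_integral_filter_of_dominated_convergence
    (fun v => levyVariance b W * (β ^ 2 * (C ^ 2 * Real.exp (-(l * ‖v‖))))) ?_ ?_ ?_ ?_
  · refine Eventually.of_forall fun T => ?_
    have hm := fun i => measurable_smoothedIndicator (hA i) (l * T)
    have hKm : Measurable (cumulantFn 0 b W) := (continuous_cumulantFn hW2).measurable
    have : Measurable fun v => (n T)⁻¹ * (β * ∑ i, θ i * smoothedIndicator (A i) (l * T) v) := by
      fun_prop
    exact ((hKm.comp this).const_mul _).aestronglyMeasurable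
  -- For T ≥ 1 the scale λT is at least λ, so the exponential tail bound applies with a₀ = λ.
  · filter_upwards [hn.eventually_gt_atTop 0, eventually_ge_atTop 1] with T hnT hT
    refine ae_of_all _ fun v => (norm_sq_mul_cumulantFn_le hb hW2 hnT _).trans ?_
    have hσ := levyVariance_nonneg (W := W) hb
    rw [mul_pow]
    gcongr
    have h1 : |∑ i, θ i * smoothedIndicator (A i) (l * T) v|
        ≤ C * Real.exp (-(l / 2 * ‖v‖)) := by
      refine (abs_sum_smoothedIndicator_le θ _ v).trans ?_
      rw [hC, mul_assoc, Finset.sum_mul]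
      refine Finset.sum_le_sum fun i _ => mul_le_mul_of_nonneg_left ?_ (abs_nonneg _)
      refine (smoothedIndicator_le_exp hd (hR i) hl (le_mul_of_one_le_right hl.le hT) v).trans
        (le_of_eq ?_)
      ring
    rw [← sq_abs]
    calc _ ≤ (C * Real.exp (-(l / 2 * ‖v‖))) ^ 2 := by gcongr
      _ = C ^ 2 * Real.exp (-(l * ‖v‖)) := by
        rw [mul_pow, ← Real.exp_nat_mul]
        congr 2
        push_cast; ring
  · exact (((integrable_exp_neg_mul_norm hd hl).const_mul _).const_mul _).const_mul _
  · have hae : ∀ᵐ v : EuclideanSpace ℝ (Fin d), ∀ i, v ∉ frontier (A i) :=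
      ae_all_iff.2 fun i => measure_eq_zero_iff_ae_notMem.1 (hAf i)
    filter_upwards [hae] with v hv
    have hlT : Tendsto (fun T : ℝ => l * T) atTop atTop := tendsto_id.const_mul_atTop hl
    have h1 : Tendsto (fun T : ℝ => β * ∑ i, θ i * smoothedIndicator (A i) (l * T) v) atTop
        (𝓝 (β * ∑ i, θ i * ((A i).indicator (fun _ => (1 : ℝ)) v * expNormIntegral d))) :=
      (tendsto_finsetSum _ fun i _ =>
        ((tendsto_smoothedIndicator hd (hA i) (hv i)).comp hlT).const_mul _).const_mul _
    convert! tendsto_sq_mul_cumulantFn (b := b) hW2 hn h1 using 2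
    have e : ∑ i, θ i * ((A i).indicator (fun _ => (1 : ℝ)) v * expNormIntegral d)
        = (∑ i, θ i * (A i).indicator (fun _ => (1 : ℝ)) v) * expNormIntegral d := by
      rw [Finset.sum_mul]
      exact Finset.sum_congr rfl fun i _ => by ring
    rw [e]
    norm_cast
    ring

variable {π : Measure (Set.Ioi (0 : ℝ))} [IsProbabilityMeasure π]

lemma sum_setIntegral_kernel_eq (hA : ∀ i, MeasurableSet (A i)) (θ : ι → ℝ) (c n : ℝ)
    (l : Set.Ioi (0 : ℝ)) {T : ℝ} (hT : 0 < T) (v : EuclideanSpace ℝ (Fin d)) :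
    ∑ i, θ i * (1 / (c * n)) * ∫ y in T • A i, kernel y (l, T • v)
      = n⁻¹ * (-(1 / (2 * c) * ((l : ℝ) ^ (d + 1))⁻¹)
        * ∑ i, θ i * smoothedIndicator (A i) (l * T) v) := by
  rw [Finset.mul_sum, Finset.mul_sum]
  refine Finset.sum_congr rfl fun i _ => ?_
  rw [setIntegral_kernel_eq (hA i) l hT]
  simp only [one_div, mul_inv]
  ring

/-- The limit of the cumulant function of the finite dimensional distributions of the integrated
field. -/
lemma tendsto_integral_cumulantFn_integratedKernel (hd : 1 ≤ d) (hb : 0 ≤ b)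
    (hW2 : Integrable (fun x : ℝ => x ^ 2) W)
    (hπ : Integrable (fun l : Set.Ioi (0 : ℝ) => ((l : ℝ) ^ (2 * d + 2))⁻¹) π)
    (hA : ∀ i, MeasurableSet (A i))
    (hAbdd : ∀ i, Bornology.IsBounded (A i)) (hAf : ∀ i, volume (frontier (A i)) = 0)
    (θ : ι → ℝ) (c : ℝ)
    (hint : ∀ T : ℝ, Integrable (fun z => cumulantFn 0 b W
      (∑ i, θ i * (1 / (c * T ^ ((d : ℝ) / 2))) * ∫ y in T • A i, kernel y z))
      (controlMeasure π)) :
    Tendsto (fun T : ℝ => ∫ z, cumulantFn 0 b W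
        (∑ i, θ i * (1 / (c * T ^ ((d : ℝ) / 2))) * ∫ y in T • A i, kernel y z)
        ∂(controlMeasure π)) atTop
      (𝓝 ((-(levyVariance b W / 2) * (expNormIntegral d / (2 * c)) ^ 2 *
        (∫ l : Set.Ioi (0 : ℝ), ((l : ℝ) ^ (2 * d + 2))⁻¹ ∂π) *
        ∫ v, (∑ i, θ i * (A i).indicator (fun _ => (1 : ℝ)) v) ^ 2 : ℝ) : ℂ)) := by
  have hd0 : (0 : ℝ) < d := by exact_mod_cast hd
  have hAfin : ∀ i, volume (A i) ≠ ⊤ := fun i => (hAbdd i).measure_lt_top.ne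
  set n : ℝ → ℝ := fun T => T ^ ((d : ℝ) / 2) with hn_def
  have hn : Tendsto n atTop atTop := tendsto_rpow_atTop (by positivity)
  have hn2 : ∀ T : ℝ, 0 < T → n T ^ 2 = T ^ d := fun T hT => by
    simp only [hn_def]
    rw [← Real.rpow_natCast, ← Real.rpow_mul hT.le, ← Real.rpow_natCast T]
    congr 1
    push_cast; ring
  set β : Set.Ioi (0 : ℝ) → ℝ := fun l => -(1 / (2 * c) * ((l : ℝ) ^ (d + 1))⁻¹) with hβ
  have hβ2 : ∀ l, β l ^ 2 = (1 / (2 * c)) ^ 2 * ((l : ℝ) ^ (2 * d + 2))⁻¹ := fun l => by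
    simp only [hβ, neg_sq, mul_pow, inv_pow, ← pow_mul]
    congr 3
    ring
  set f : ℝ → Set.Ioi (0 : ℝ) → EuclideanSpace ℝ (Fin d) → ℂ := fun T l u => cumulantFn 0 b W
      (∑ i, θ i * (1 / (c * T ^ ((d : ℝ) / 2))) * ∫ y in T • A i, kernel y (l, u)) with hf
  -- Substitution u = T • v; the Jacobian T^d is exactly the square of the normalisation.
  have hscale : ∀ (T : ℝ) (l : Set.Ioi (0 : ℝ)), 0 < T → ∫ u, f T l u = ∫ v, ((n T ^ 2 : ℝ) : ℂ) *
        cumulantFn 0 b W ((n T)⁻¹ * (β l * ∑ i, θ i * smoothedIndicator (A i) (l * T) v)) := by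
    intro T l hT
    have h := Measure.integral_comp_smul (volume : Measure (EuclideanSpace ℝ (Fin d))) (f T l) T
    rw [finrank_euclideanSpace, Fintype.card_fin, abs_of_pos (by positivity),
      eq_inv_smul_iff₀ (by positivity)] at h
    rw [← h, integral_const_mul, hn2 T hT, Complex.real_smul]
    congr 2
    ext v
    simp only [hf]
    rw [sum_setIntegral_kernel_eq hA θ c _ l hT]
  have e1 : ∀ T : ℝ, ∫ z, cumulantFn 0 b W
        (∑ i, θ i * (1 / (c * T ^ ((d : ℝ) / 2))) * ∫ y in T • A i, kernel y z)
        ∂(controlMeasure π) = ∫ l, (∫ u, f T l u) ∂π := fun T => integral_prod _ (hint T)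
  simp_rw [e1]
  set Q : ℝ := ∫ v, (∑ i, θ i * (A i).indicator (fun _ => (1 : ℝ)) v) ^ 2 with hQ
  have e2 : ((-(levyVariance b W / 2) * (expNormIntegral d / (2 * c)) ^ 2 *
        (∫ l : Set.Ioi (0 : ℝ), ((l : ℝ) ^ (2 * d + 2))⁻¹ ∂π) * Q : ℝ) : ℂ)
      = ∫ l, ((-(levyVariance b W / 2) * (β l * expNormIntegral d) ^ 2 * Q : ℝ) : ℂ) ∂π := by
    rw [integral_complex_ofReal]
    congr 1
    simp_rw [mul_pow, hβ2]
    rw [integral_mul_const, integral_const_mul, integral_mul_const, integral_const_mul]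
    ring
  rw [e2]
  -- This constant depends on neither λ nor T, so the dominating function varies with λ only through
  -- β², that is λ^{-(2d+2)}, which `hπ` makes integrable.
  set C : ℝ := ((∑ i, |θ i|) * expNormIntegral d)
        * ∑ i, |θ i| * (volume.real (A i) * expNormIntegral d) with hC
  refine tendsto_integral_filter_of_dominated_convergence
    (fun l => levyVariance b W * ((1 / (2 * c)) ^ 2 * ((l : ℝ) ^ (2 * d + 2))⁻¹ * C)) ?_ ?_ ?_ ?_
  · exact Eventually.of_forall fun T => (Integrable.integral_prod_left (hint T)).1
  · filter_upwards [eventually_gt_atTop 0, hn.eventually_gt_atTop 0] with T hT hnT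
    refine ae_of_all _ fun l => ?_
    rw [hscale T l hT]
    have hi := integrable_sum_smoothedIndicator_sq hd hA hAfin θ (l * T)
    refine (norm_integral_le_of_norm_le ((hi.const_mul (β l ^ 2)).const_mul (levyVariance b W))
      (ae_of_all _ fun v => ?_)).trans ?_
    · have := norm_sq_mul_cumulantFn_le hb hW2 hnT
        (β l * ∑ i, θ i * smoothedIndicator (A i) (l * T) v)
      rwa [mul_pow (β l)] at this
    · rw [integral_const_mul, integral_const_mul, ← hβ2]
      have hσ := levyVariance_nonneg (W := W) hb
      gcongr
      exact integral_sum_smoothedIndicator_sq_le hd hA hAfin θ _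
  · exact ((hπ.const_mul _).mul_const _).const_mul _
  · refine ae_of_all _ fun l => ?_
    refine (tendsto_integral_smoothedIndicator hd hb hW2 hA hAbdd hAf θ (β l) l.2 hn).congr' ?_
    filter_upwards [eventually_gt_atTop 0] with T hT
    exact (hscale T l hT).symm

end Limit

/-! ### Characteristic functions and convergence in distribution. -/

section ConvergenceInDistribution

variable {Ω Ω' : Type*} [MeasurableSpace Ω] [MeasurableSpace Ω'] {P : Measure Ω}
  {P' : Measure Ω'}

lemma charFun_map_toLp {k : ℕ} {Y : Ω → Fin k → ℝ} (hY : AEMeasurable Y P)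
    (θ : EuclideanSpace ℝ (Fin k)) :
    charFun (P.map fun ω => WithLp.toLp 2 (Y ω)) θ
      = ∫ ω, Complex.exp (Complex.I * ((∑ i, θ i * Y ω i : ℝ) : ℂ)) ∂P := by
  have hm : AEMeasurable (fun ω => WithLp.toLp 2 (Y ω)) P := by fun_prop
  rw [charFun_apply, integral_map hm (by fun_prop)]
  congr 1; ext ω
  rw [mul_comm Complex.I]
  simp [PiLp.inner_apply]

variable [IsProbabilityMeasure P] [IsProbabilityMeasure P']

/-- The Cramér–Wold device: convergence of the characteristic functions of all linear combinations
implies convergence in distribution of random vectors. -/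
lemma tendstoInDistribution_of_tendsto_charFun {k : ℕ} {Y : ℝ → Ω → Fin k → ℝ}
    {Z : Ω' → Fin k → ℝ} (hY : ∀ T, AEMeasurable (Y T) P) (hZ : AEMeasurable Z P')
    (h : ∀ θ : Fin k → ℝ,
      Tendsto (fun T => ∫ ω, Complex.exp (Complex.I * ((∑ i, θ i * Y T ω i : ℝ) : ℂ)) ∂P) atTop
        (𝓝 (∫ ω, Complex.exp (Complex.I * ((∑ i, θ i * Z ω i : ℝ) : ℂ)) ∂P'))) :
    TendstoInDistribution Y atTop Z (fun _ => P) P' := by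
  have hE : TendstoInDistribution (fun T ω => WithLp.toLp 2 (Y T ω)) atTop
      (fun ω => WithLp.toLp 2 (Z ω)) (fun _ => P) P' := by
    refine ⟨fun T => by have := hY T; fun_prop, by fun_prop, ?_⟩
    -- Lévy's continuity theorem is applied along arbitrary sequences T = u m → ∞.
    refine tendsto_of_seq_tendsto fun u hu => ?_
    refine ProbabilityMeasure.tendsto_iff_tendsto_charFun.2 fun θ => ?_
    change Tendsto (fun m => charFun (P.map fun ω => WithLp.toLp 2 (Y (u m) ω)) θ) atTop
      (𝓝 (charFun (P'.map fun ω => WithLp.toLp 2 (Z ω)) θ))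
    rw [charFun_map_toLp hZ]
    simp_rw [charFun_map_toLp (hY _)]
    exact (h θ).comp hu
  exact hE.continuous_comp (PiLp.continuous_ofLp 2 _)

/-- A linear combination of values of a Gaussian process is Gaussian; its mean is 0 and its variance
expands through Cov(B_s, B_t) = min(s, t). -/
lemma charFun_sum_of_isBrownianReal {B : ℝ≥0 → Ω → ℝ} (hB : IsBrownianReal B P) {k : ℕ}
    (t : Fin k → ℝ≥0) (θ : Fin k → ℝ) :
    ∫ ω, Complex.exp (Complex.I * ((∑ i, θ i * B (t i) ω : ℝ) : ℂ)) ∂P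
      = Complex.exp ((-(1 / 2) * ∑ i, ∑ j, θ i * θ j * min (t i : ℝ) (t j) : ℝ) : ℂ) := by
  have hpre := hB.toIsPreBrownianReal
  have hG : HasGaussianLaw (fun ω => ∑ i, θ i * B (t i) ω) P :=
    ((hpre.isGaussianProcess.comp_right t).smul θ).hasGaussianLaw_fun_sum (I := Finset.univ)
  have h := hG.charFun_map_eq 1
  rw [charFun_apply, integral_map hG.aemeasurable (by fun_prop)] at h
  have hmem : ∀ s, MemLp (B s) 2 P := fun s =>
    (hpre.isGaussianProcess.hasGaussianLaw_eval s).memLp_two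
  have hint : ∀ i, Integrable (fun ω => θ i * B (t i) ω) P := fun i =>
    (hpre.integrable_eval (t i)).const_mul _
  have hmean : ∫ ω, ∑ i, θ i * B (t i) ω ∂P = 0 := by
    rw [integral_finsetSum _ fun i _ => hint i]
    exact Finset.sum_eq_zero fun i _ => by rw [integral_const_mul, hpre.integral_eval, mul_zero]
  have hvar : Var[fun ω => ∑ i, θ i * B (t i) ω; P]
      = ∑ i, ∑ j, θ i * θ j * min (t i : ℝ) (t j) := by
    rw [variance_fun_sum fun i => (hmem (t i)).const_mul (θ i)]
    refine Finset.sum_congr rfl fun i _ => Finset.sum_congr rfl fun j _ => ?_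
    rw [covariance_const_mul_left, covariance_const_mul_right, hpre.covariance_fun_eval]
    push_cast
    ring
  have e : ∀ x : ℝ, inner ℝ (1 : ℝ) x = x := fun x => by simp
  have e' : ∀ x : ℝ, inner ℝ x (1 : ℝ) = x := fun x => by simp
  simp only [e, e', hmean, hvar] at h
  simp_rw [mul_comm Complex.I]
  rw [h]
  congr 1
  push_cast
  ring

end ConvergenceInDistribution

/-! ### Dilations of a convex set and their overlaps. -/

section Dilation

variable {d : ℕ} {Δ : Set (EuclideanSpace ℝ (Fin d))}

/-- Convex sets have null frontier. This lets Δ, which is not assumed measurable, be replaced by its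
interior; at T = 0 both dilates are {0}. -/
lemma smul_interior_ae_eq (hΔ : Convex ℝ Δ) (hΔ0 : 0 ∈ interior Δ) (T : ℝ) :
    (T • interior Δ : Set (EuclideanSpace ℝ (Fin d))) =ᵐ[volume] (T • Δ : Set _) := by
  rcases eq_or_ne T 0 with rfl | hT
  · rw [Set.zero_smul_set ⟨0, hΔ0⟩, Set.zero_smul_set ⟨0, interior_subset hΔ0⟩]
    exact EventuallyEq.rfl
  · rw [← interior_smul₀ hT]
    exact interior_ae_eq_of_null_frontier ((hΔ.smul T).addHaar_frontier volume)

lemma smul_subset_smul_of_le (hΔ : Convex ℝ Δ) (hΔ0 : 0 ∈ Δ) {r s : ℝ} (hr : 0 ≤ r)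
    (hrs : r ≤ s) : r • Δ ⊆ s • Δ := by
  rcases hr.eq_or_lt with rfl | hr'
  · rw [Set.zero_smul_set ⟨0, hΔ0⟩]
    intro x hx
    rw [Set.mem_zero.1 hx]
    exact ⟨0, hΔ0, smul_zero s⟩
  · rintro _ ⟨x, hx, rfl⟩
    have hs : 0 < s := hr'.trans_le hrs
    refine ⟨(r / s) • x, hΔ.smul_mem_of_zero_mem hΔ0 hx ⟨by positivity, (div_le_one hs).2 hrs⟩, ?_⟩
    simp only [smul_smul]
    rw [mul_div_cancel₀ _ hs.ne']

/-- Dilates of a convex set containing 0 are nested, so the intersection is the smaller one; the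
exponent 1/d makes its volume linear in t. This is where the Brownian covariance arises. -/
lemma volume_real_smul_inter_smul (hd : 1 ≤ d) (hΔ : Convex ℝ Δ) (hΔ0 : 0 ∈ Δ) (t s : ℝ≥0) :
    volume.real ((((t : ℝ) ^ (1 / (d : ℝ))) • Δ) ∩ (((s : ℝ) ^ (1 / (d : ℝ))) • Δ))
      = min (t : ℝ) s * volume.real Δ := by
  wlog hts : t ≤ s generalizing t s
  · rw [Set.inter_comm, min_comm]
    exact this s t (le_of_not_ge hts)
  have hsub : ((t : ℝ) ^ (1 / (d : ℝ))) • Δ ⊆ ((s : ℝ) ^ (1 / (d : ℝ))) • Δ :=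
    smul_subset_smul_of_le hΔ hΔ0 (by positivity)
      (Real.rpow_le_rpow t.coe_nonneg (by exact_mod_cast hts) (by positivity))
  rw [Set.inter_eq_left.2 hsub, min_eq_left (by exact_mod_cast hts), Measure.real, Measure.addHaar_smul_of_nonneg _
    (by positivity), finrank_euclideanSpace, Fintype.card_fin, one_div,
    Real.rpow_inv_natCast_pow t.coe_nonneg (by omega), ENNReal.toReal_mul, ENNReal.toReal_ofReal t.coe_nonneg]
  rfl

lemma integral_sum_indicator_sq {ι : Type*} [Fintype ι]
    {A : ι → Set (EuclideanSpace ℝ (Fin d))} (hA : ∀ i, MeasurableSet (A i))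
    (hAfin : ∀ i, volume (A i) ≠ ⊤) (θ : ι → ℝ) :
    ∫ v, (∑ i, θ i * (A i).indicator (fun _ => (1 : ℝ)) v) ^ 2
      = ∑ i, ∑ j, θ i * θ j * volume.real (A i ∩ A j) := by
  have e : ∀ v, (∑ i, θ i * (A i).indicator (fun _ => (1 : ℝ)) v) ^ 2
      = ∑ i, ∑ j, θ i * θ j * (A i ∩ A j).indicator (fun _ => (1 : ℝ)) v := fun v => by
    rw [sq, Finset.sum_mul_sum]
    refine Finset.sum_congr rfl fun i _ => Finset.sum_congr rfl fun j _ => ?_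
    by_cases h1 : v ∈ A i <;> by_cases h2 : v ∈ A j <;> simp [h1, h2]
  have hi : ∀ i j, Integrable fun v =>
      θ i * θ j * (A i ∩ A j).indicator (fun _ => (1 : ℝ)) v := fun i j => by
    refine Integrable.const_mul ?_ _
    exact (integrable_indicator_iff ((hA i).inter (hA j))).2 (integrableOn_const
      (measure_ne_top_of_subset Set.inter_subset_left (hAfin i)))
  simp_rw [e]
  rw [integral_finsetSum _ fun i _ => integrable_finsetSum _ fun j _ => hi i j]
  refine Finset.sum_congr rfl fun i _ => ?_
  rw [integral_finsetSum _ fun j _ => hi i j]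
  refine Finset.sum_congr rfl fun j _ => ?_
  rw [integral_const_mul, integral_indicator_const _ ((hA i).inter (hA j)), smul_eq_mul, mul_one]

end Dilation

/-! ### Identification of the limit with Brownian motion. -/

section Main

variable {d : ℕ} {Ω : Type*} [MeasurableSpace Ω] {P : Measure Ω} [IsProbabilityMeasure P]
  {b : ℝ} {W : Measure ℝ} {π : Measure (Set.Ioi (0 : ℝ))}
  {X : EuclideanSpace ℝ (Fin d) → Ω → ℝ} {Δ : Set (EuclideanSpace ℝ (Fin d))}

lemma aemeasurable_integratedField (hXmeas : AEMeasurable (Function.uncurry X) (volume.prod P))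
    (T : ℝ) : AEMeasurable (integratedField Δ X T) P := by
  have hXm : AEStronglyMeasurable (Function.uncurry X) ((volume.restrict (T • Δ)).prod P) :=
    (hXmeas.mono_ac (Measure.restrict_le_self.absolutelyContinuous.prod
      Measure.AbsolutelyContinuous.rfl)).aestronglyMeasurable
  exact hXm.prod_swap.integral_prod_right'.aemeasurable

lemma integral_inv_pow_pos [IsProbabilityMeasure π] (m : ℕ)
    (hπ : Integrable (fun l : Set.Ioi (0 : ℝ) => ((l : ℝ) ^ m)⁻¹) π) :
    0 < ∫ l : Set.Ioi (0 : ℝ), ((l : ℝ) ^ m)⁻¹ ∂π := by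
  have hpos : ∀ l : Set.Ioi (0 : ℝ), 0 < ((l : ℝ) ^ m)⁻¹ := fun l =>
    inv_pos.2 (pow_pos l.2 m)
  rw [integral_pos_iff_support_of_nonneg (fun l => (hpos l).le) hπ]
  have : Function.support (fun l : Set.Ioi (0 : ℝ) => ((l : ℝ) ^ m)⁻¹) = Set.univ :=
    Set.eq_univ_of_forall fun l => (hpos l).ne'
  rw [this, measure_univ]
  exact one_pos

/-- The Gamma quotient in `c5` is M/2, the 1/2 being the one in the kernel. -/
lemma c5_eq (hd : 1 ≤ d) : c5 Δ π = volume.real Δ * (expNormIntegral d / 2) ^ 2 *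
    ∫ l : Set.Ioi (0 : ℝ), ((l : ℝ) ^ (2 * d + 2))⁻¹ ∂π := by
  rw [expNormIntegral_eq hd, mul_div_cancel_left₀ _ (two_ne_zero)]
  rfl

lemma expNormIntegral_pos (hd : 1 ≤ d) : 0 < expNormIntegral d := by
  have hd0 : (0 : ℝ) < d := by exact_mod_cast hd
  rw [expNormIntegral_eq hd]
  have h1 := Real.Gamma_pos_of_pos hd0
  have h2 := Real.Gamma_pos_of_pos (half_pos hd0)
  positivity

variable [IsProbabilityMeasure π]

/-- The characteristic functions of the finite dimensional distributions of the normalised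
integrated field converge to those of Brownian motion. -/
lemma tendsto_charFun_integratedField (hd : 1 ≤ d) (hb : 0 < b)
    (hW2 : Integrable (fun x : ℝ => x ^ 2) W)
    (hπ : Integrable (fun l : Set.Ioi (0 : ℝ) => ((l : ℝ) ^ (2 * d + 2))⁻¹) π)
    (hX : IsSupCARField P 0 b W π X)
    (hXmeas : AEMeasurable (Function.uncurry X) (volume.prod P))
    (hΔmeas : MeasurableSet Δ) (hΔconv : Convex ℝ Δ)
    (hΔbdd : Bornology.IsBounded Δ) (hΔ0 : 0 ∈ interior Δ) {k : ℕ} (t : Fin k → ℝ≥0)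
    (θ : Fin k → ℝ) :
    Tendsto (fun T : ℝ => ∫ ω, Complex.exp (Complex.I * ((∑ i, θ i *
        (1 / (√(c5 Δ π * levyVariance b W) * T ^ ((d : ℝ) / 2))
          * integratedField Δ X ((t i : ℝ) ^ (1 / (d : ℝ)) * T) ω) : ℝ) : ℂ)) ∂P) atTop
      (𝓝 (Complex.exp ((-(1 / 2) * ∑ i, ∑ j, θ i * θ j * min (t i : ℝ) (t j) : ℝ) : ℂ))) := by
  set c : ℝ := √(c5 Δ π * levyVariance b W) with hc
  set A : Fin k → Set (EuclideanSpace ℝ (Fin d)) := fun i => ((t i : ℝ) ^ (1 / (d : ℝ))) • Δ with hA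
  have hAmeas : ∀ i, MeasurableSet (A i) := fun i => hΔmeas.const_smul₀ _
  have hAbdd : ∀ i, Bornology.IsBounded (A i) := fun i => hΔbdd.smul₀ _
  have hAf : ∀ i, volume (frontier (A i)) = 0 := fun i => (hΔconv.smul _).addHaar_frontier volume
  have hπd := integrable_inv_pow_of_le (show d ≤ 2 * d + 2 by omega) hπ
  have hTA : ∀ (i : Fin k) (T : ℝ), ((t i : ℝ) ^ (1 / (d : ℝ)) * T) • Δ = T • A i := fun i T => by
    rw [hA, smul_smul, mul_comm]
  have hchar := fun T : ℝ => charFun_sum_setIntegral hd hb hW2 hπd hX hXmeas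
    (fun i => (hAbdd i).smul₀ T) fun i => θ i * (1 / (c * T ^ ((d : ℝ) / 2)))
  have hlim := tendsto_integral_cumulantFn_integratedKernel hd hb.le hW2 hπ hAmeas hAbdd hAf θ c
    fun T => (hchar T).1
  have hexp := (Complex.continuous_exp.tendsto _).comp hlim
  have hJ := integral_inv_pow_pos _ hπ
  have hσ := levyVariance_pos (W := W) hb
  have hM := expNormIntegral_pos hd
  have hV : 0 < volume.real Δ := by
    refine ENNReal.toReal_pos ?_ hΔbdd.measure_lt_top.ne
    exact (Measure.measure_pos_of_nonempty_interior volume ⟨0, hΔ0⟩).ne'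
  -- All factors are positive, so the square root is genuine and c² cancels the coefficient of the
  -- limiting quadratic form, leaving -1/2.
  have hc2 : c ^ 2 = volume.real Δ * (expNormIntegral d / 2) ^ 2 *
      (∫ l : Set.Ioi (0 : ℝ), ((l : ℝ) ^ (2 * d + 2))⁻¹ ∂π) * levyVariance b W := by
    rw [hc, c5_eq hd, Real.sq_sqrt (by positivity)]
  rw [integral_sum_indicator_sq hAmeas fun i => (hAbdd i).measure_lt_top.ne] at hexp
  simp_rw [hA, volume_real_smul_inter_smul hd hΔconv (interior_subset hΔ0)] at hexp
  convert! hexp using 1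
  · ext T
    rw [Function.comp_apply, ← (hchar T).2]
    congr 1; ext ω
    congr 4
    funext i
    rw [integratedField, hTA]
    ring
  · congr 3
    have e : ∑ i, ∑ j, θ i * θ j * (min (t i : ℝ) (t j) * volume.real Δ)
        = (∑ i, ∑ j, θ i * θ j * min (t i : ℝ) (t j)) * volume.real Δ := by
      rw [Finset.sum_mul]
      refine Finset.sum_congr rfl fun i _ => ?_
      rw [Finset.sum_mul]
      exact Finset.sum_congr rfl fun j _ => by ring
    rw [e, div_pow, mul_pow, hc2]
    generalize (∫ l : Set.Ioi (0 : ℝ), ((l : ℝ) ^ (2 * d + 2))⁻¹ ∂π) = J at hJ ⊢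
    field_simp

end Main

end SupCAR

end

theorem theorem4 {d : ℕ} (hd : 1 ≤ d)
    {Ω : Type*} [MeasurableSpace Ω] (P : Measure Ω) [IsProbabilityMeasure P]
    (b : ℝ) (hb : 0 < b)
    (W : Measure ℝ) (hW : SupCAR.IsLevyMeasure W) (hW2 : Integrable (fun x : ℝ => x ^ 2) W)
    (π : Measure (Set.Ioi (0 : ℝ))) [IsProbabilityMeasure π]
    (hπ : Integrable (fun l : Set.Ioi (0 : ℝ) => ((l : ℝ) ^ (2 * d + 2))⁻¹) π)
    (X : EuclideanSpace ℝ (Fin d) → Ω → ℝ)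
    (hX : SupCAR.IsSupCARField P 0 b W π X)
    (hXmeas : AEMeasurable (Function.uncurry X) (volume.prod P))
    (Δ : Set (EuclideanSpace ℝ (Fin d))) (hΔconv : Convex ℝ Δ)
    (hΔbdd : Bornology.IsBounded Δ) (hΔ0 : 0 ∈ interior Δ)
    {Ω' : Type*} [MeasurableSpace Ω'] (P' : Measure Ω') [IsProbabilityMeasure P']
    (B : ℝ≥0 → Ω' → ℝ) (hB : IsBrownianReal B P') :
    (∀ T : ℝ, ∀ᵐ ω ∂P, IntegrableOn (fun y => X y ω) (T • Δ)) ∧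
    ∀ (k : ℕ) (t : Fin k → ℝ≥0), (∀ i, t i ≤ 1) →
      TendstoInDistribution
        (fun (T : ℝ) (ω : Ω) (i : Fin k) =>
          1 / (√(-(SupCAR.c5 Δ π * (iteratedDeriv 2 (SupCAR.cumulantFn 0 b W) 0).re))
              * T ^ ((d : ℝ) / 2))
            * SupCAR.integratedField Δ X ((t i : ℝ) ^ (1 / (d : ℝ)) * T) ω)
        atTop (fun (ω' : Ω') (i : Fin k) => B (t i) ω') (fun _ => P) P' := by
  have hπd := SupCAR.integrable_inv_pow_of_le (show d ≤ 2 * d + 2 by omega) hπ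
  refine ⟨fun T => ?_, fun k t _ => ?_⟩
  · obtain ⟨S, Λ, hS, hΛ, hXΛ⟩ := hX
    exact (SupCAR.exists_mem_integralGraph_setIntegral hd hb hW2 hπd hS hΛ hXΛ hXmeas
      (hΔbdd.smul₀ T)).1
  -- The interior is open, hence measurable, and still convex, bounded and a neighbourhood of 0;
  -- neither the integrated field nor `c5` sees the null frontier.
  · have hint : SupCAR.integratedField Δ X = SupCAR.integratedField (interior Δ) X := by
      ext T ω
      exact setIntegral_congr_set (SupCAR.smul_interior_ae_eq hΔconv hΔ0 T).symm
    have hc5 : SupCAR.c5 Δ π = SupCAR.c5 (interior Δ) π := by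
      rw [SupCAR.c5, SupCAR.c5, measure_interior_of_null_frontier (hΔconv.addHaar_frontier volume)]
    have hK : -(SupCAR.c5 Δ π * (iteratedDeriv 2 (SupCAR.cumulantFn 0 b W) 0).re)
        = SupCAR.c5 (interior Δ) π * SupCAR.levyVariance b W := by
      rw [SupCAR.iteratedDeriv_two_cumulantFn hW2, hc5, Complex.neg_re, Complex.ofReal_re]
      ring
    rw [hK, hint]
    refine SupCAR.tendstoInDistribution_of_tendsto_charFun
      (fun T => aemeasurable_pi_lambda _ fun i =>
        (SupCAR.aemeasurable_integratedField hXmeas _).const_mul _)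
      (aemeasurable_pi_lambda _ fun i => hB.toIsPreBrownianReal.aemeasurable (t i)) fun θ => ?_
    rw [SupCAR.charFun_sum_of_isBrownianReal hB]
    exact SupCAR.tendsto_charFun_integratedField hd hb hW2 hπ hX hXmeas
      isOpen_interior.measurableSet hΔconv.interior (hΔbdd.subset interior_subset)
      (by rwa [interior_interior]) t θ
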